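/- **Model.** $n$ users are placed independently and uniformly in the unit square. There is a library of $m$ files; every user caches one file, and requests one file, the requests being independent samples, independent of positions and caches, from the Zipf distribution $f_i = i^{-\gamma_r}/\sum_{j=1}^m j^{-\gamma_r}$, $1\le i\le m$. A caching policy is any (possibly randomized, centralized and position-dependent) rule that chooses all cached files without knowledge of the requests. Given a collaboration distance $r$, the link from user $u$ to another user $v$ is potentially active if $|u-v|<r$, $u$ caches the file that $v$ requests, and $v$ does not cache that file itself. Two potentially active links $u\to v$ and $u'\to v'$ conflict if $u'$ is within distance $r$ of $v$ or $u$ is within distance $r$ of $v'$. Let $L$ be the largest number of potentially active links no two of which conflict. **Theorem.** Let $0\le\gamma_r<1$ and $\eta=\frac{1-\gamma_r}{2-\gamma_r}$. (i) (Upper bound) There is a constant $C$ depending only on $\gamma_r$ such that for all $n$, $m$, every collaboration distance $r$ and every caching policy, $E[L]\le C\,\frac{n}{m^{\eta}}$. In particular $E[L]=O(n/m^{\eta})$ for any caching policy. (ii) (Achievability) Let $0<\epsilon<\frac16$. If $\eta+\epsilon<1-\gamma_r$, which is automatic when $\gamma_r\le\frac12$, there is an exponent $\gamma_c>0$ with $$\frac{(1-\gamma_r)\gamma_c}{1-\gamma_r+\gamma_c}=\eta+\epsilon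 .$$ For every $\gamma_c>0$ satisfying this equation, whenever the library size $m=m(n)$ satisfies $m(n)\to\infty$ and $m(n)=o(n)$, the collaboration distance $r(n)>0$ satisfies $r(n)=\Theta\big(\sqrt{m^{\eta+\epsilon}/n}\big)$, and users cache independently according to the Zipf distribution with exponent $\gamma_c$ on the $m$ files, one has $E[L]=\Theta\big(n/m^{\eta+\epsilon}\big)$ as $n\to\infty$. -/

import Mathlib

open MeasureTheory ProbabilityTheory Filter Asymptotics

namespace D2D

/-- The plane with its Euclidean distance. -/
abbrev Plane : Type := EuclideanSpace ℝ (Fin 2)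

/-- The unit square (the cell). -/
def unitSquare : Set Plane := {x | ∀ i, x i ∈ Set.Icc (0 : ℝ) 1}

/-- The uniform distribution on the unit square, which has area one. -/
noncomputable def uniformSquare : Measure Plane := volume.restrict unitSquare

/-- Zipf probability of a file: files are numbered `0, …, m - 1`, and the file numbered `i` has
rank `i + 1`. -/
noncomputable def zipfProb (γ : ℝ) (m : ℕ) (i : Fin m) : ℝ :=
  (1 / ((i : ℝ) + 1) ^ γ) / ∑ j : Fin m, 1 / ((j : ℝ) + 1) ^ γ

/-- The Zipf distribution with exponent `γ` on a library of `m` files. -/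
noncomputable def zipf (γ : ℝ) (m : ℕ) : Measure (Fin m) :=
  ∑ i : Fin m, ENNReal.ofReal (zipfProb γ m i) • Measure.dirac i

section Links

variable {n m : ℕ} (r : ℝ) (x : Fin n → Plane) (c z : Fin n → Fin m)

/-- The link from transmitter `l.1` to receiver `l.2` is potentially active, for positions `x`,
cached files `c`, requested files `z` and collaboration distance `r`: the users are distinct and
closer than `r`, the transmitter caches the file that the receiver requests, and the receiver does
not find that file in its own cache (such a self-request activates no link). -/
def PotentiallyActive (l : Fin n × Fin n) : Prop :=
  l.1 ≠ l.2 ∧ dist (x l.1) (x l.2) < r ∧ c l.1 = z l.2 ∧ c l.2 ≠ z l.2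

/-- The conflict graph of the protocol model: its vertices are the potentially active links, and
two links conflict if the transmitter of one is within range `r` of the receiver of the other. -/
def conflictGraph : SimpleGraph {l : Fin n × Fin n // PotentiallyActive r x c z l} where
  Adj k l := k ≠ l ∧ (dist (x l.1.1) (x k.1.2) ≤ r ∨ dist (x k.1.1) (x l.1.2) ≤ r)
  symm := ⟨fun _ _ h => ⟨h.1.symm, h.2.symm⟩⟩
  loopless := ⟨fun _ h => h.1 rfl⟩

/-- The number `L` of active links: the largest number of potentially active links that can be
scheduled simultaneously. -/
noncomputable def activeLinks : ℕ := (conflictGraph r x c z).indepNum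

end Links

/-- The joint law of positions, cached files and requested files. The positions of the `n` users
are independent and uniform in the unit square; the caching policy `κ`, which may be centralized,
randomized and aware of the positions, fills the caches given the positions, one file per user;
the requests are independent Zipf samples, independent of positions and caches. -/
noncomputable def networkLaw (γr : ℝ) (n m : ℕ) (κ : Kernel (Fin n → Plane) (Fin n → Fin m)) :
    Measure (((Fin n → Plane) × (Fin n → Fin m)) × (Fin n → Fin m)) :=
  ((Measure.pi fun _ : Fin n => uniformSquare) ⊗ₘ κ).prod (Measure.pi fun _ : Fin n => zipf γr m)

/-- The expected number `E[L]` of active links. -/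
noncomputable def expectedActiveLinks (γr : ℝ) (n m : ℕ) (r : ℝ)
    (κ : Kernel (Fin n → Plane) (Fin n → Fin m)) : ℝ :=
  ∫ ω, (activeLinks r ω.1.1 ω.1.2 ω.2 : ℝ) ∂(networkLaw γr n m κ)

/-- Independent Zipf caching: every user caches, independently of everything else, a file sampled
from the Zipf distribution with exponent `γc`. -/
noncomputable def zipfCaching (γc : ℝ) (n m : ℕ) : Kernel (Fin n → Plane) (Fin n → Fin m) :=
  Kernel.const _ (Measure.pi fun _ : Fin n => zipf γc m)

/-- The exponent `η = (1 - γ_r) / (2 - γ_r)`. -/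
noncomputable def eta (γr : ℝ) : ℝ := (1 - γr) / (2 - γr)

end D2D

/-! Upper bound for every policy. Write `a = 1 - γr` and fix a rank `K`. Receivers in a schedule are
distinct, so links are counted through receivers. A request has rank at most `K` with probability of
order `(K/m)^a`. A request of higher rank hits a given cached file with probability at most `1/(K^γr
* m^a)`, whatever the policy, because requests are independent of positions and caches. Counting all
pairs within range would cost `n² r²` times this, which is too much for large `r`. Short links are
therefore counted by packing. The conflict rule has no guard zone, so nearly parallel links of
length close to `r` can crowd together, but links shorter than `(1 - δ) r` number only `O(1/(δ r²))`
(`card_short_links_le`). The remaining pairs lie in an annulus of area `O(δ r²)`.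
`expectedActiveLinks_le_general` adds up the three contributions. With `δ r²` of order `K/n` and `K
= m^η` all of them are `O(n/K)`, since `η` solves `(K/m)^a = 1/K`.

Zipf caching. Put `θ = η + ε`; `θ > η` forces `γc > 1`, so the caching law has a summable tail. At
`K = m^(θ/γc)` that tail, of order `K^(1-γc)`, replaces the annulus factor, and the same general
bound gives `O(n/m^θ)` when `n r² = O(m^θ)` (`expectedActiveLinks_zipfCaching_le`). For the lower
bound, place order `1/r²`, that is `n/m^θ`, cells so that links inside different cells never
conflict. In a cell, each file of rank about `K` has order one expected cachers and order `1/K`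
expected requesters that cache the most popular file instead. Summed over about `K` such files, the
expected number of matches is bounded below; a second moment argument
(`le_measureReal_exists_match`) turns this into a constant probability of a link per cell
(`le_expectedActiveLinks_of_density`). -/

namespace D2D

/-! ### Schedules as finite sets of links, and measurability of `L`. -/

section Schedules

variable {n m : ℕ}

/-- A set of potentially active links no two of which conflict. -/
def IsSchedule (r : ℝ) (x : Fin n → Plane) (c z : Fin n → Fin m)
    (S : Finset (Fin n × Fin n)) : Prop :=
  (∀ l ∈ S, PotentiallyActive r x c z l) ∧
    ∀ k ∈ S, ∀ l ∈ S, k ≠ l → r < dist (x k.1) (x l.2)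

theorem IsSchedule.card_le_activeLinks {r : ℝ} {x : Fin n → Plane} {c z : Fin n → Fin m}
    {S : Finset (Fin n × Fin n)} (hS : IsSchedule r x c z S) :
    S.card ≤ activeLinks r x c z := by
  classical
  have h : (conflictGraph r x c z).IsIndepSet
      ((S.subtype (PotentiallyActive r x c z) : Finset _) : Set _) := by
    intro k hk l hl hkl hadj
    rw [Finset.mem_coe, Finset.mem_subtype] at hk hl
    have hne : (k : Fin n × Fin n) ≠ l := fun e => hkl (Subtype.ext e)
    rcases hadj.2 with h | h
    · exact absurd (hS.2 _ hl _ hk hne.symm) (not_lt.2 h)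
    · exact absurd (hS.2 _ hk _ hl hne) (not_lt.2 h)
  have := h.card_le_indepNum
  rwa [Finset.card_subtype, Finset.filter_true_of_mem hS.1] at this

theorem exists_isSchedule_card_eq (r : ℝ) (x : Fin n → Plane) (c z : Fin n → Fin m) :
    ∃ S, IsSchedule r x c z S ∧ S.card = activeLinks r x c z := by
  classical
  obtain ⟨s, hs⟩ := (conflictGraph r x c z).exists_isNIndepSet_indepNum
  refine ⟨s.map (Function.Embedding.subtype _), ⟨?_, ?_⟩, ?_⟩
  · intro l hl
    obtain ⟨l, -, rfl⟩ := Finset.mem_map.1 hl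
    exact l.2
  · intro k hk l hl hkl
    obtain ⟨k, hk', rfl⟩ := Finset.mem_map.1 hk
    obtain ⟨l, hl', rfl⟩ := Finset.mem_map.1 hl
    have hne : k ≠ l := fun e => hkl (by rw [e])
    by_contra hcon
    exact hs.1 hk' hl' hne ⟨hne, Or.inr (not_lt.1 hcon)⟩
  · rw [Finset.card_map]; exact hs.2

theorem le_activeLinks_iff (r : ℝ) (x : Fin n → Plane) (c z : Fin n → Fin m) (k : ℕ) :
    k ≤ activeLinks r x c z ↔ ∃ S, IsSchedule r x c z S ∧ k ≤ S.card := by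
  constructor
  · intro h
    obtain ⟨S, hS, hc⟩ := exists_isSchedule_card_eq r x c z
    exact ⟨S, hS, hc ▸ h⟩
  · rintro ⟨S, hS, hk⟩
    exact hk.trans hS.card_le_activeLinks

/-- In a schedule a link is determined by its receiver. -/
theorem IsSchedule.injOn_snd {r : ℝ} {x : Fin n → Plane} {c z : Fin n → Fin m}
    {S : Finset (Fin n × Fin n)} (hS : IsSchedule r x c z S) :
    Set.InjOn Prod.snd (S : Set (Fin n × Fin n)) := by
  intro k hk l hl h
  by_contra hne
  -- With a common receiver, each transmitter is in range of the other link's receiver, which is a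
  -- conflict.
  have h1 := hS.2 k hk l hl hne
  have h2 := (hS.1 k hk).2.1
  rw [h] at h2
  exact absurd h1 (not_lt.2 h2.le)

theorem measurableSet_isSchedule (r : ℝ) (S : Finset (Fin n × Fin n)) :
    MeasurableSet {ω : ((Fin n → Plane) × (Fin n → Fin m)) × (Fin n → Fin m) |
      IsSchedule r ω.1.1 ω.1.2 ω.2 S} := by
  have hx : ∀ u : Fin n, Measurable
      fun ω : ((Fin n → Plane) × (Fin n → Fin m)) × (Fin n → Fin m) => ω.1.1 u := fun u =>
    (measurable_pi_apply u).comp (measurable_fst.comp measurable_fst)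
  have hc : ∀ u : Fin n, Measurable
      fun ω : ((Fin n → Plane) × (Fin n → Fin m)) × (Fin n → Fin m) => ω.1.2 u := fun u =>
    (measurable_pi_apply u).comp (measurable_snd.comp measurable_fst)
  have hz : ∀ u : Fin n, Measurable
      fun ω : ((Fin n → Plane) × (Fin n → Fin m)) × (Fin n → Fin m) => ω.2 u := fun u =>
    (measurable_pi_apply u).comp measurable_snd
  have e : {ω : ((Fin n → Plane) × (Fin n → Fin m)) × (Fin n → Fin m) |
      IsSchedule r ω.1.1 ω.1.2 ω.2 S} =
      (⋂ l ∈ S, ({_ω | l.1 ≠ l.2} ∩ {ω | dist (ω.1.1 l.1) (ω.1.1 l.2) < r} ∩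
        {ω | ω.1.2 l.1 = ω.2 l.2} ∩ {ω | ω.1.2 l.2 = ω.2 l.2}ᶜ)) ∩
      ⋂ k ∈ S, ⋂ l ∈ S, ⋂ _ : k ≠ l, {ω | r < dist (ω.1.1 k.1) (ω.1.1 l.2)} := by
    ext ω
    simp [IsSchedule, PotentiallyActive, and_assoc]
  rw [e]
  refine MeasurableSet.inter ?_ ?_
  · refine Finset.measurableSet_biInter _ fun l _ => ?_
    exact (((MeasurableSet.const _).inter (measurableSet_lt ((hx _).dist (hx _))
      measurable_const)).inter (measurableSet_eq_fun (hc _) (hz _))).inter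
        (measurableSet_eq_fun (hc _) (hz _)).compl
  · refine Finset.measurableSet_biInter _ fun k _ => Finset.measurableSet_biInter _ fun l _ =>
      MeasurableSet.iInter fun _ => ?_
    exact measurableSet_lt measurable_const ((hx _).dist (hx _))

/-- The event `k ≤ L` is a finite union, over link sets of size at least `k`, of the events that the
set is a schedule. -/
theorem measurable_activeLinks (r : ℝ) :
    Measurable fun ω : ((Fin n → Plane) × (Fin n → Fin m)) × (Fin n → Fin m) =>
      activeLinks r ω.1.1 ω.1.2 ω.2 := by
  refine measurable_of_Ici fun k => ?_
  have : (fun ω : ((Fin n → Plane) × (Fin n → Fin m)) × (Fin n → Fin m) =>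
      activeLinks r ω.1.1 ω.1.2 ω.2) ⁻¹' Set.Ici k =
      ⋃ S : Finset (Fin n × Fin n), ⋃ _ : k ≤ S.card, {ω | IsSchedule r ω.1.1 ω.1.2 ω.2 S} := by
    ext ω
    simp only [Set.mem_preimage, Set.mem_Ici, le_activeLinks_iff, Set.mem_iUnion,
      Set.mem_ofPred_eq, exists_prop]
    exact exists_congr fun S => and_comm
  rw [this]
  exact MeasurableSet.iUnion fun S => MeasurableSet.iUnion fun _ => measurableSet_isSchedule r S

theorem activeLinks_le (r : ℝ) (x : Fin n → Plane) (c z : Fin n → Fin m) :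
    activeLinks r x c z ≤ n := by
  classical
  obtain ⟨S, hS, hc⟩ := exists_isSchedule_card_eq r x c z
  rw [← hc, ← Finset.card_image_of_injOn hS.injOn_snd]
  exact (Finset.card_le_univ _).trans (by simp)

/-- Receivers that find their request at a user whose distance lies in `[ρ, r)`. -/
def IsServed (ρ r : ℝ) (x : Fin n → Plane) (c z : Fin n → Fin m) (v : Fin n) : Prop :=
  ∃ u, u ≠ v ∧ ρ ≤ dist (x u) (x v) ∧ dist (x u) (x v) < r ∧ c u = z v

open Classical in
-- Links of length at least `ρ` inject into served receivers, so conflicts need not be examined any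
-- further for them.
theorem IsSchedule.card_le {ρ r : ℝ} {x : Fin n → Plane} {c z : Fin n → Fin m}
    {S : Finset (Fin n × Fin n)} (hS : IsSchedule r x c z S) :
    S.card ≤ (S.filter fun l => dist (x l.1) (x l.2) < ρ).card +
      (Finset.univ.filter (IsServed ρ r x c z)).card := by
  rw [← Finset.card_filter_add_card_filter_not (s := S) fun l => dist (x l.1) (x l.2) < ρ]
  gcongr
  refine Finset.card_le_card_of_injOn Prod.snd ?_ (hS.injOn_snd.mono fun l hl => ?_)
  swap
  · exact (Finset.mem_filter.1 hl).1
  intro l hl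
  simp only [Finset.coe_filter, not_lt, Set.mem_ofPred_eq] at hl
  have h := hS.1 l hl.1
  simp only [Finset.coe_filter, Finset.mem_univ, true_and, Set.mem_ofPred_eq]
  exact ⟨l.1, h.1, hl.2, h.2.1, h.2.2.1⟩

end Schedules

/-! ### Packing of short non-conflicting links in the plane. -/

/-- Core planar estimate, in coordinates: `w` points from the first receiver to its transmitter,
`d` from the first receiver to the second. -/
theorem normSq_sub_lt_of_sector {r δ w₁ w₂ d₁ d₂ : ℝ} (hr : 0 < r) (hδ : 0 < δ) (hδ1 : δ ≤ 1)
    (hw : w₁ ^ 2 + w₂ ^ 2 < ((1 - δ) * r) ^ 2) (hs : |w₂| ≤ w₁)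
    (hd₁ : 0 ≤ d₁) (hd₁' : d₁ ≤ r / 4) (hd₂ : |d₂| ≤ δ * r / 4) :
    (w₁ - d₁) ^ 2 + (w₂ - d₂) ^ 2 ≤ r ^ 2 := by
  have hw2 := abs_le.1 hs
  have hw1 : 0 ≤ w₁ := (abs_nonneg _).trans hs
  have hδr : 0 < δ * r := by positivity
  have hsq : ((1 - δ) * r) ^ 2 ≤ r ^ 2 := by
    have h0 : 0 ≤ (1 - δ) * r := mul_nonneg (by linarith) hr.le
    exact pow_le_pow_left₀ h0 (by nlinarith) 2
  -- If `d` is mostly along the axis, then `w · d ≥ w₁ d₁ / 2`; moving by `d` does not lengthen `w`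
  -- once `w₁ ≥ 5/4 d₁`, and otherwise all coordinates are small against `r`. If not, `d` has length
  -- at most `δ r`, and the triangle inequality (through Cauchy–Schwarz) uses up the slack `δ r` in
  -- the length of `w`.
  by_cases hc : 2 * |d₂| ≤ d₁
  · have h2 := abs_le.1 (by linarith : |d₂| ≤ d₁ / 2)
    have hdot : -(w₁ * (d₁ / 2)) ≤ w₂ * d₂ := by
      have : |w₂ * d₂| ≤ w₁ * (d₁ / 2) := by
        rw [abs_mul]; exact mul_le_mul hs (by linarith) (abs_nonneg _) hw1
      exact (abs_le.1 this).1
    have hd2sq : d₂ ^ 2 ≤ (d₁ / 2) ^ 2 := by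
      rw [← sq_abs d₂]; exact pow_le_pow_left₀ (abs_nonneg _) (by linarith) 2
    by_cases hbig : 5 / 4 * d₁ ≤ w₁
    · nlinarith [mul_nonneg hd₁ (sub_nonneg.2 hbig)]
    · have hw1' : w₁ ≤ 5 / 16 * r := by linarith
      have e1 : |w₁ - d₁| ≤ 5 / 16 * r := by rw [abs_le]; constructor <;> linarith
      have e2 : |w₂ - d₂| ≤ 9 / 16 * r := by rw [abs_le]; constructor <;> linarith
      have f1 := pow_le_pow_left₀ (abs_nonneg _) e1 2
      have f2 := pow_le_pow_left₀ (abs_nonneg _) e2 2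
      rw [sq_abs] at f1 f2
      nlinarith [sq_nonneg r]
  · have hd1 : d₁ ≤ δ * r / 2 := by linarith
    have hd2 := abs_le.1 hd₂
    have hdd : d₁ ^ 2 + d₂ ^ 2 ≤ (δ * r) ^ 2 := by
      have f1 := pow_le_pow_left₀ hd₁ hd1 2
      have f2 := pow_le_pow_left₀ (abs_nonneg _) hd₂ 2
      rw [sq_abs] at f2
      nlinarith [sq_nonneg (δ * r)]
    have h0 : 0 ≤ (1 - δ) * r := mul_nonneg (by linarith) hr.le
    have hcs : (w₁ * d₁ + w₂ * d₂) ^ 2 ≤ (((1 - δ) * r) * (δ * r)) ^ 2 := by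
      calc (w₁ * d₁ + w₂ * d₂) ^ 2 ≤ (w₁ ^ 2 + w₂ ^ 2) * (d₁ ^ 2 + d₂ ^ 2) := by
            nlinarith [sq_nonneg (w₁ * d₂ - w₂ * d₁)]
        _ ≤ ((1 - δ) * r) ^ 2 * (δ * r) ^ 2 := by
            apply mul_le_mul hw.le hdd <;> positivity
        _ = _ := by ring
    have hdot := (abs_le.1 (abs_le_of_sq_le_sq hcs (by positivity))).1
    nlinarith

theorem dist_sq_plane (p q : Plane) : dist p q ^ 2 = (p 0 - q 0) ^ 2 + (p 1 - q 1) ^ 2 := by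
  rw [EuclideanSpace.dist_eq, Real.sq_sqrt (by positivity), Fin.sum_univ_two, Real.dist_eq,
    Real.dist_eq, sq_abs, sq_abs]

/-- The sector (main axis and orientation) in which a displacement points. -/
noncomputable def sector (w : Plane) : Fin 2 × Bool :=
  if |w 1| ≤ |w 0| then (0, decide (0 ≤ w 0)) else (1, decide (0 ≤ w 1))

/-- The class of a link in the packing argument: its sector, a coarse bin for the receiver along
the main axis and a fine bin across it. -/
noncomputable def linkClass (r δ : ℝ) (u v : Plane) : (Fin 2 × Bool) × ℕ × ℕ :=
  (sector (u - v), ⌊v (sector (u - v)).1 / (r / 4)⌋₊,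
    ⌊v (1 - (sector (u - v)).1) / (δ * r / 4)⌋₊)

theorem abs_sub_le_of_floor_eq {a b s : ℝ} (hs : 0 < s) (ha : 0 ≤ a) (hb : 0 ≤ b)
    (h : ⌊a / s⌋₊ = ⌊b / s⌋₊) : |a - b| ≤ s := by
  have h1 := Nat.floor_le (div_nonneg ha hs.le)
  have h2 := Nat.floor_le (div_nonneg hb hs.le)
  have h3 := Nat.lt_floor_add_one (a / s)
  have h4 := Nat.lt_floor_add_one (b / s)
  rw [h] at h1 h3
  have e : a - b = (a / s - b / s) * s := by field_simp
  rw [e, abs_mul, abs_of_pos hs]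
  have : |a / s - b / s| ≤ 1 := by rw [abs_le]; constructor <;> linarith
  nlinarith

/-- The sign `σ` orients the main axis along `w`. In `Fin 2`, `1 - i` is the other axis, so this is
the cone condition of `normSq_sub_lt_of_sector`. -/
theorem sector_spec (w : Plane) :
    ∃ σ : ℝ, (σ = if (sector w).2 then 1 else -1) ∧ |w (1 - (sector w).1)| ≤ σ * w (sector w).1 := by
  by_cases h : |w 1| ≤ |w 0|
  · have e : sector w = (0, decide (0 ≤ w 0)) := if_pos h
    rw [e]
    by_cases h1 : 0 ≤ w 0
    · exact ⟨1, by simp [h1], by simpa [abs_of_nonneg h1] using h⟩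
    · exact ⟨-1, by simp [h1], by simpa [abs_of_neg (not_le.1 h1)] using h⟩
  · have e : sector w = (1, decide (0 ≤ w 1)) := if_neg h
    have h' := (not_le.1 h).le
    rw [e]
    by_cases h1 : 0 ≤ w 1
    · exact ⟨1, by simp [h1], by simpa [abs_of_nonneg h1] using h'⟩
    · exact ⟨-1, by simp [h1], by simpa [abs_of_neg (not_le.1 h1)] using h'⟩

theorem dist_sq_axis (p q : Plane) (i : Fin 2) :
    dist p q ^ 2 = (p i - q i) ^ 2 + (p (1 - i) - q (1 - i)) ^ 2 := by
  rw [dist_sq_plane]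
  fin_cases i
  · simp
  · simp [add_comm]

/-- Two non-conflicting short links lie in different classes. -/
theorem linkClass_ne {r δ : ℝ} (hr : 0 < r) (hδ : 0 < δ) (hδ1 : δ ≤ 1) {u v u' v' : Plane}
    (hv : v ∈ unitSquare) (hv' : v' ∈ unitSquare)
    (h : dist u v < (1 - δ) * r) (h' : dist u' v' < (1 - δ) * r)
    (hc : r < dist u v') (hc' : r < dist u' v) :
    linkClass r δ u v ≠ linkClass r δ u' v' := by
  intro heq
  -- If `v'` lies ahead of `v` in the common direction of the links, then `u` is within range of
  -- `v'`.
  have key : ∀ (u v u' v' : Plane), v ∈ unitSquare → v' ∈ unitSquare →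
      dist u v < (1 - δ) * r → r < dist u v' → linkClass r δ u v = linkClass r δ u' v' →
      ∀ σ : ℝ, (σ = if (sector (u - v)).2 then 1 else -1) →
      0 ≤ σ * (v' (sector (u - v)).1 - v (sector (u - v)).1) → False := by
    intro u v u' v' hv hv' h hc heq σ hσ hpos
    have hs : sector (u - v) = sector (u' - v') := congrArg Prod.fst heq
    have h1 : ⌊v (sector (u - v)).1 / (r / 4)⌋₊ = ⌊v' (sector (u' - v')).1 / (r / 4)⌋₊ :=
      congrArg (fun t => t.2.1) heq
    have h2 : ⌊v (1 - (sector (u - v)).1) / (δ * r / 4)⌋₊ =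
        ⌊v' (1 - (sector (u' - v')).1) / (δ * r / 4)⌋₊ := congrArg (fun t => t.2.2) heq
    rw [← hs] at h1 h2
    obtain ⟨σ', hσ', hw⟩ := sector_spec (u - v)
    have hσσ : σ' = σ := hσ'.trans hσ.symm
    subst hσσ
    set i := (sector (u - v)).1
    have hσsq : σ' ^ 2 = 1 := by rw [hσ]; split_ifs <;> norm_num
    have hσabs : |σ'| = 1 := by rw [hσ]; split_ifs <;> norm_num
    have a1 := abs_sub_le_of_floor_eq (by positivity) (hv' i).1 (hv i).1 h1.symm
    have a2 := abs_sub_le_of_floor_eq (by positivity) (hv' (1 - i)).1 (hv (1 - i)).1 h2.symm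
    have hsq : dist u v ^ 2 < ((1 - δ) * r) ^ 2 := pow_lt_pow_left₀ h dist_nonneg two_ne_zero
    rw [dist_sq_axis _ _ i] at hsq
    have := normSq_sub_lt_of_sector (w₁ := σ' * (u i - v i)) (w₂ := u (1 - i) - v (1 - i))
      (d₁ := σ' * (v' i - v i)) (d₂ := v' (1 - i) - v (1 - i)) hr hδ hδ1
      (by rw [mul_pow, hσsq, one_mul]; exact hsq) (by simpa using hw) hpos
      (by
        refine (le_abs_self _).trans ?_
        rw [abs_mul, hσabs, one_mul]; exact a1) a2
    have hfin : dist u v' ^ 2 ≤ r ^ 2 := by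
      rw [dist_sq_axis _ _ i]
      calc _ = (σ' * (u i - v i) - σ' * (v' i - v i)) ^ 2 +
            (u (1 - i) - v (1 - i) - (v' (1 - i) - v (1 - i))) ^ 2 := by
              rw [← mul_sub, mul_pow, hσsq]; ring
        _ ≤ _ := this
    exact absurd (pow_lt_pow_left₀ hc hr.le two_ne_zero) (not_lt.2 hfin)
  have hs : sector (u - v) = sector (u' - v') := congrArg Prod.fst heq
  -- One of the two receivers is ahead of the other; the roles are exchanged if needed.
  rcases le_total 0 ((if (sector (u - v)).2 then (1 : ℝ) else -1) *
      (v' (sector (u - v)).1 - v (sector (u - v)).1)) with hp | hp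
  · exact key u v u' v' hv hv' h hc heq _ rfl hp
  · refine key u' v' u v hv' hv h' hc' heq.symm _ rfl ?_
    rw [← hs]
    linarith

/-- Packing bound for short links: although the protocol model has no guard zone, links that are
shorter than `(1 - δ) r` number at most `O(1 / (δ r²))`. -/
theorem card_short_links_le {n m : ℕ} {r δ : ℝ} (hr : 0 < r) (hr2 : r ≤ 2) (hδ : 0 < δ)
    (hδ1 : δ ≤ 1) {x : Fin n → Plane} (hx : ∀ u, x u ∈ unitSquare) {c z : Fin n → Fin m}
    {S : Finset (Fin n × Fin n)} (hS : IsSchedule r x c z S)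
    (hshort : ∀ l ∈ S, dist (x l.1) (x l.2) < (1 - δ) * r) :
    (S.card : ℝ) ≤ 144 / (δ * r ^ 2) := by
  classical
  have hinj : Set.InjOn (fun l : Fin n × Fin n => linkClass r δ (x l.1) (x l.2))
      (S : Set (Fin n × Fin n)) := by
    intro k hk l hl h
    by_contra hne
    exact linkClass_ne hr hδ hδ1 (hx _) (hx _) (hshort k hk) (hshort l hl)
      (hS.2 k hk l hl hne) (hS.2 l hl k hk (Ne.symm hne)) h
  have hmaps : Set.MapsTo (fun l : Fin n × Fin n => linkClass r δ (x l.1) (x l.2)) S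
      ((Finset.univ : Finset (Fin 2 × Bool)) ×ˢ Finset.range (⌊1 / (r / 4)⌋₊ + 1) ×ˢ
        Finset.range (⌊1 / (δ * r / 4)⌋₊ + 1) : Finset _) := by
    intro l _
    simp only [linkClass, Finset.coe_product, Finset.coe_univ, Set.mem_prod, Set.mem_univ,
      Finset.mem_coe, Finset.mem_range, true_and, Nat.lt_succ_iff]
    constructor <;> refine Nat.floor_le_floor ?_ <;> gcongr <;> exact (hx _ _).2
  have hcard := Finset.card_le_card_of_injOn _ hmaps hinj
  rw [Finset.card_product, Finset.card_product, Finset.card_range, Finset.card_range] at hcard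
  -- `r ≤ 2` absorbs the extra bin: `1 ≤ 2 / r`. Four sectors and two factors 6 make 144.
  have h1 : ((⌊1 / (r / 4)⌋₊ + 1 : ℕ) : ℝ) ≤ 6 / r := by
    push_cast
    have := Nat.floor_le (by positivity : 0 ≤ 1 / (r / 4))
    have e : 1 / (r / 4) = 4 / r := by field_simp
    have : (1 : ℝ) ≤ 2 / r := by rwa [le_div_iff₀ hr, one_mul]
    have e2 : 6 / r = 4 / r + 2 / r := by ring
    linarith
  have h2 : ((⌊1 / (δ * r / 4)⌋₊ + 1 : ℕ) : ℝ) ≤ 6 / (δ * r) := by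
    push_cast
    have := Nat.floor_le (by positivity : 0 ≤ 1 / (δ * r / 4))
    have e : 1 / (δ * r / 4) = 4 / (δ * r) := by field_simp
    have : (1 : ℝ) ≤ 2 / (δ * r) := by
      rw [le_div_iff₀ (by positivity), one_mul]; nlinarith
    have e2 : 6 / (δ * r) = 4 / (δ * r) + 2 / (δ * r) := by ring
    linarith
  have h4 : (Finset.univ : Finset (Fin 2 × Bool)).card = 4 := by simp
  calc (S.card : ℝ) ≤ ((4 * ((⌊1 / (r / 4)⌋₊ + 1) * (⌊1 / (δ * r / 4)⌋₊ + 1)) : ℕ) : ℝ) := by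
        rw [h4] at hcard; exact_mod_cast hcard
    _ = 4 * (((⌊1 / (r / 4)⌋₊ + 1 : ℕ) : ℝ) * ((⌊1 / (δ * r / 4)⌋₊ + 1 : ℕ) : ℝ)) := by
        push_cast; ring
    _ ≤ 4 * (6 / r * (6 / (δ * r))) := by gcongr
    _ = 144 / (δ * r ^ 2) := by field_simp; norm_num

/-! ### Zipf normalizing sums, heads and tails. -/

section ZipfSums

/-- The normalizing constant of the Zipf distribution. -/
noncomputable def zipfSum (γ : ℝ) (m : ℕ) : ℝ := ∑ j : Fin m, 1 / ((j : ℝ) + 1) ^ γ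

theorem zipfProb_eq (γ : ℝ) (m : ℕ) (i : Fin m) :
    zipfProb γ m i = (1 / ((i : ℝ) + 1) ^ γ) / zipfSum γ m := rfl

theorem one_le_zipfSum {γ : ℝ} {m : ℕ} (hm : 0 < m) : 1 ≤ zipfSum γ m := by
  have h := Finset.single_le_sum (f := fun j : Fin m => 1 / ((j : ℝ) + 1) ^ γ)
    (fun j _ => by positivity) (Finset.mem_univ (⟨0, hm⟩ : Fin m))
  simpa [zipfSum] using h

theorem zipfSum_pos {γ : ℝ} {m : ℕ} (hm : 0 < m) : 0 < zipfSum γ m :=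
  one_pos.trans_le (one_le_zipfSum hm)

theorem zipfProb_nonneg (γ : ℝ) (m : ℕ) (i : Fin m) : 0 ≤ zipfProb γ m i := by
  unfold zipfProb; positivity

theorem sum_zipfProb {γ : ℝ} {m : ℕ} (hm : 0 < m) : ∑ i, zipfProb γ m i = 1 := by
  simp_rw [zipfProb_eq]
  rw [← Finset.sum_div]
  exact div_self (zipfSum_pos hm).ne'

theorem rpow_le_zipfSum {γ : ℝ} (hγ : 0 ≤ γ) {m : ℕ} (hm : 0 < m) :
    (m : ℝ) ^ (1 - γ) ≤ zipfSum γ m := by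
  have hm' : (0 : ℝ) < m := by exact_mod_cast hm
  calc (m : ℝ) ^ (1 - γ) = ∑ _j : Fin m, 1 / (m : ℝ) ^ γ := by
        rw [Real.rpow_sub hm', Real.rpow_one]; simp [div_eq_mul_inv]
    _ ≤ _ := by
        refine Finset.sum_le_sum fun j _ => ?_
        have : ((j : ℝ) + 1) ≤ m := by exact_mod_cast j.2
        gcongr

/-- A discrete derivative bound behind the comparison of power sums with integrals. -/
theorem one_sub_mul_le_rpow {x b : ℝ} (hx : 0 < x) (hb : 0 ≤ b) :
    1 + b * (1 - x) ≤ x ^ (-b) := by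
  rw [Real.rpow_def_of_pos hx]
  have h1 := Real.add_one_le_exp (Real.log x * -b)
  have h2 := Real.log_le_sub_one_of_pos hx
  nlinarith

/-- Bernoulli's inequality for the concave power `1 - γ` shows that each term is at most the
increment of `x ^ (1 - γ) / (1 - γ)` over a unit step, and the increments telescope. -/
theorem sum_range_one_div_rpow_le {γ : ℝ} (hγ0 : 0 ≤ γ) (hγ : γ < 1) (k : ℕ) :
    ∑ j ∈ Finset.range k, 1 / ((j : ℝ) + 1) ^ γ ≤ (k : ℝ) ^ (1 - γ) / (1 - γ) := by
  have ha : 0 < 1 - γ := by linarith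
  induction k with
  | zero => simp [Real.zero_rpow ha.ne']
  | succ k ih =>
    rw [Finset.sum_range_succ]
    have hk : (0 : ℝ) < (k : ℝ) + 1 := by positivity
    have hb := _root_.rpow_one_add_le_one_add_mul_self (s := -1 / ((k : ℝ) + 1)) (p := 1 - γ)
      (by rw [le_div_iff₀ hk]; nlinarith [(Nat.cast_nonneg k : (0 : ℝ) ≤ k)]) ha.le (by linarith)
    have e : 1 + -1 / ((k : ℝ) + 1) = k / (k + 1) := by field_simp; ring
    rw [e, Real.div_rpow (by positivity) hk.le, div_le_iff₀ (by positivity)] at hb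
    have e2 : ((k : ℝ) + 1) ^ (1 - γ) = (k + 1) * (1 / (k + 1) ^ γ) := by
      rw [Real.rpow_sub hk, Real.rpow_one]; ring
    have e3 : (1 + (1 - γ) * (-1 / ((k : ℝ) + 1))) * (k + 1) ^ (1 - γ) =
        (k + 1) ^ (1 - γ) - (1 - γ) * (1 / (k + 1) ^ γ) := by
      rw [e2]; field_simp; ring
    rw [e3] at hb
    push_cast
    rw [le_div_iff₀ ha] at ih ⊢
    linarith

theorem zipfSum_le {γ : ℝ} (hγ0 : 0 ≤ γ) (hγ : γ < 1) (m : ℕ) :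
    zipfSum γ m ≤ (m : ℝ) ^ (1 - γ) / (1 - γ) := by
  unfold zipfSum
  rw [Fin.sum_univ_eq_sum_range (fun j : ℕ => 1 / ((j : ℝ) + 1) ^ γ) m]
  exact sum_range_one_div_rpow_le hγ0 hγ m

/-- Probability that a request has rank at most `K`. -/
theorem sum_zipfProb_rank_le {γ : ℝ} (hγ0 : 0 ≤ γ) (hγ : γ < 1) {m : ℕ} (hm : 0 < m) {K : ℝ}
    (hK : 0 ≤ K) :
    ∑ i ∈ Finset.univ.filter (fun i : Fin m => (i : ℝ) + 1 ≤ K), zipfProb γ m i ≤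
      (K / m) ^ (1 - γ) / (1 - γ) := by
  have ha : 0 < 1 - γ := by linarith
  have hm' : (0 : ℝ) < m := by exact_mod_cast hm
  have h1 : ∑ i ∈ Finset.univ.filter (fun i : Fin m => (i : ℝ) + 1 ≤ K), 1 / ((i : ℝ) + 1) ^ γ ≤
      K ^ (1 - γ) / (1 - γ) := by
    calc _ = ∑ j ∈ (Finset.univ.filter fun i : Fin m => (i : ℝ) + 1 ≤ K).map Fin.valEmbedding,
          1 / ((j : ℝ) + 1) ^ γ := by rw [Finset.sum_map]; rfl
      _ ≤ ∑ j ∈ Finset.range ⌊K⌋₊, 1 / ((j : ℝ) + 1) ^ γ := by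
          refine Finset.sum_le_sum_of_subset_of_nonneg ?_ fun _ _ _ => by positivity
          intro j hj
          obtain ⟨i, hi, rfl⟩ := Finset.mem_map.1 hj
          have hi := (Finset.mem_filter.1 hi).2
          rw [Finset.mem_range, ← Nat.succ_le_iff]
          exact Nat.le_floor (by push_cast; exact hi)
      _ ≤ (⌊K⌋₊ : ℝ) ^ (1 - γ) / (1 - γ) := sum_range_one_div_rpow_le hγ0 hγ _
      _ ≤ _ := by gcongr; exact Nat.floor_le hK
  simp_rw [zipfProb_eq]
  rw [← Finset.sum_div, Real.div_rpow hK hm'.le]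
  calc _ ≤ (K ^ (1 - γ) / (1 - γ)) / (m : ℝ) ^ (1 - γ) :=
        div_le_div₀ (by positivity) h1 (by positivity) (rpow_le_zipfSum hγ0 hm)
    _ = _ := by ring

theorem zipfProb_le_of_lt_rank {γ : ℝ} (hγ0 : 0 ≤ γ) {m : ℕ} (hm : 0 < m) {K : ℝ}
    (hK : 0 < K) {i : Fin m} (hi : K < (i : ℝ) + 1) :
    zipfProb γ m i ≤ 1 / (K ^ γ * (m : ℝ) ^ (1 - γ)) := by
  have hm' : (0 : ℝ) < m := by exact_mod_cast hm
  rw [zipfProb_eq, div_div]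
  have := rpow_le_zipfSum hγ0 hm
  gcongr

/-- Telescoping again: `one_sub_mul_le_rpow` at `x = y / (y + 1)` bounds each term by a decrement of
`y ^ (1 - γ) / (γ - 1)`. Keeping the subtracted end term makes the induction close. -/
theorem sum_Ico_one_div_rpow_le {γ : ℝ} (hγ : 1 < γ) {k : ℕ} (hk : 0 < k) (d : ℕ) :
    ∑ j ∈ Finset.Ico k (k + d), 1 / ((j : ℝ) + 1) ^ γ ≤
      ((k : ℝ) ^ (1 - γ) - ((k + d : ℕ) : ℝ) ^ (1 - γ)) / (γ - 1) := by
  have hb : 0 < γ - 1 := by linarith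
  induction d with
  | zero => simp
  | succ d ih =>
    rw [← add_assoc, Finset.sum_Ico_succ_top (by omega)]
    have hj : (0 : ℝ) < ((k + d : ℕ) : ℝ) := by exact_mod_cast (by omega : 0 < k + d)
    set y : ℝ := ((k + d : ℕ) : ℝ)
    have hy : 0 < y + 1 := by positivity
    have h := one_sub_mul_le_rpow (x := y / (y + 1)) (b := γ - 1) (by positivity) hb.le
    rw [neg_sub, Real.div_rpow hj.le hy.le, le_div_iff₀ (by positivity)] at h
    have e2 : (y + 1) ^ (1 - γ) = (y + 1) * (1 / (y + 1) ^ γ) := by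
      rw [Real.rpow_sub hy, Real.rpow_one]; ring
    have e3 : (1 + (γ - 1) * (1 - y / (y + 1))) * (y + 1) ^ (1 - γ) =
        (y + 1) ^ (1 - γ) + (γ - 1) * (1 / (y + 1) ^ γ) := by
      rw [e2]; field_simp; ring
    rw [e3] at h
    rw [le_div_iff₀ hb] at ih ⊢
    push_cast at ih ⊢
    have e4 : y = (k : ℝ) + d := by simp [y]
    rw [← e4]
    linarith

/-- For exponents above one, a tail of the harmonic-type series. -/
theorem sum_one_div_rpow_tail_le {γ : ℝ} (hγ : 1 < γ) (m : ℕ) {K : ℝ} (hK : 1 ≤ K) :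
    ∑ i ∈ Finset.univ.filter (fun i : Fin m => K < (i : ℝ) + 1), 1 / ((i : ℝ) + 1) ^ γ ≤
      2 ^ (γ - 1) / (γ - 1) * K ^ (1 - γ) := by
  have hb : 0 < γ - 1 := by linarith
  have hfl : 0 < ⌊K⌋₊ := Nat.floor_pos.2 hK
  have hfl' : (0 : ℝ) < (⌊K⌋₊ : ℝ) := by exact_mod_cast hfl
  -- Rounding `K` down loses at most a factor 2, the source of `2 ^ (γ - 1)`.
  have hK2 : K / 2 ≤ (⌊K⌋₊ : ℝ) := by
    have h1 := Nat.lt_floor_add_one K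
    have h2 : (1 : ℝ) ≤ (⌊K⌋₊ : ℝ) := by exact_mod_cast hfl
    linarith
  calc _ = ∑ j ∈ (Finset.univ.filter fun i : Fin m => K < (i : ℝ) + 1).map Fin.valEmbedding,
        1 / ((j : ℝ) + 1) ^ γ := by rw [Finset.sum_map]; rfl
    _ ≤ ∑ j ∈ Finset.Ico ⌊K⌋₊ (⌊K⌋₊ + m), 1 / ((j : ℝ) + 1) ^ γ := by
        refine Finset.sum_le_sum_of_subset_of_nonneg ?_ fun _ _ _ => by positivity
        intro j hj
        obtain ⟨i, hi, rfl⟩ := Finset.mem_map.1 hj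
        have hi := (Finset.mem_filter.1 hi).2
        rw [Finset.mem_Ico]
        refine ⟨?_, lt_of_lt_of_le i.2 (by omega)⟩
        rw [← Nat.lt_succ_iff]
        exact (Nat.floor_lt (by linarith)).2 (by push_cast; exact hi)
    _ ≤ ((⌊K⌋₊ : ℝ) ^ (1 - γ) - ((⌊K⌋₊ + m : ℕ) : ℝ) ^ (1 - γ)) / (γ - 1) :=
        sum_Ico_one_div_rpow_le hγ hfl m
    _ ≤ (⌊K⌋₊ : ℝ) ^ (1 - γ) / (γ - 1) := by
        gcongr
        have : 0 ≤ ((⌊K⌋₊ + m : ℕ) : ℝ) ^ (1 - γ) := by positivity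
        linarith
    _ ≤ (K / 2) ^ (1 - γ) / (γ - 1) := by
        gcongr ?_ / _
        exact Real.rpow_le_rpow_of_nonpos (by linarith) hK2 (by linarith)
    _ = _ := by
        rw [Real.div_rpow (by linarith) (by norm_num), ← neg_sub γ 1,
          Real.rpow_neg (by norm_num : (0 : ℝ) ≤ 2)]
        field_simp

/-- The bound does not depend on `m`: under Zipf caching with `γ > 1` the most popular file keeps a
probability bounded below. -/
theorem zipfSum_le_of_one_lt {γ : ℝ} (hγ : 1 < γ) (m : ℕ) :
    zipfSum γ m ≤ 1 + 2 ^ (γ - 1) / (γ - 1) := by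
  unfold zipfSum
  rw [← Finset.sum_filter_add_sum_filter_not Finset.univ (fun i : Fin m => (i : ℝ) + 1 ≤ 1)]
  simp_rw [not_le]
  refine add_le_add ?_ ?_
  · calc ∑ i ∈ Finset.univ.filter (fun i : Fin m => (i : ℝ) + 1 ≤ 1), 1 / ((i : ℝ) + 1) ^ γ
        ≤ ∑ i ∈ Finset.univ.filter (fun i : Fin m => (i : ℝ) + 1 ≤ 1), (1 : ℝ) := by
          refine Finset.sum_le_sum fun i _ => ?_
          rw [div_le_one (by positivity)]
          exact Real.one_le_rpow (by simp) (by linarith)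
      _ ≤ 1 := by
          rw [Finset.sum_const, nsmul_one]
          have : (Finset.univ.filter fun i : Fin m => (i : ℝ) + 1 ≤ 1).card ≤ 1 := by
            refine Finset.card_le_one.2 fun i hi j hj => ?_
            have hi := (Finset.mem_filter.1 hi).2
            have hj := (Finset.mem_filter.1 hj).2
            ext
            have h1 : (i : ℝ) ≤ 0 := by linarith
            have h2 : (j : ℝ) ≤ 0 := by linarith
            have h1' : (i : ℕ) ≤ 0 := by exact_mod_cast h1
            have h2' : (j : ℕ) ≤ 0 := by exact_mod_cast h2
            omega
          exact_mod_cast this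
  · simpa using sum_one_div_rpow_tail_le hγ m le_rfl

end ZipfSums

/-! ### The Zipf law as a measure. -/

section ZipfMeasure

theorem zipf_apply (γ : ℝ) (m : ℕ) (s : Set (Fin m)) [DecidablePred (· ∈ s)] :
    zipf γ m s = ENNReal.ofReal (∑ i : Fin m with i ∈ s, zipfProb γ m i) := by
  rw [ENNReal.ofReal_sum_of_nonneg fun i _ => zipfProb_nonneg γ m i, Finset.sum_filter]
  unfold zipf
  rw [Measure.finsetSum_apply]
  refine Finset.sum_congr rfl fun i _ => ?_
  by_cases h : i ∈ s <;> simp [h]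

theorem isProbabilityMeasure_zipf (γ : ℝ) {m : ℕ} (hm : 0 < m) :
    IsProbabilityMeasure (zipf γ m) := by
  classical
  refine ⟨?_⟩
  rw [zipf_apply]
  simp [sum_zipfProb hm]

theorem zipf_singleton (γ : ℝ) (m : ℕ) (i : Fin m) :
    zipf γ m {i} = ENNReal.ofReal (zipfProb γ m i) := by
  classical
  rw [zipf_apply]
  congr 1
  rw [Finset.sum_eq_single i] <;> simp +contextual

end ZipfMeasure

/-! ### Uniform positions: boxes, balls, annuli and pairs of users. -/

section Uniform

theorem volume_plane_box (a b : Fin 2 → ℝ) :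
    volume {x : Plane | ∀ i, x i ∈ Set.Icc (a i) (b i)} =
      ENNReal.ofReal (b 0 - a 0) * ENNReal.ofReal (b 1 - a 1) := by
  have h := (EuclideanSpace.volume_preserving_symm_measurableEquiv_toLp (Fin 2)).measure_preimage
    (s := Set.Icc a b) measurableSet_Icc.nullMeasurableSet
  rw [Real.volume_Icc_pi, Fin.prod_univ_two] at h
  rw [← h]
  congr 1
  ext x
  simp only [Set.mem_ofPred_eq, Set.mem_preimage, Set.mem_Icc, Pi.le_def]
  exact ⟨fun h => ⟨fun i => (h i).1, fun i => (h i).2⟩, fun h i => ⟨h.1 i, h.2 i⟩⟩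

theorem measurableSet_plane_box (a b : Fin 2 → ℝ) :
    MeasurableSet {x : Plane | ∀ i, x i ∈ Set.Icc (a i) (b i)} := by
  have : {x : Plane | ∀ i, x i ∈ Set.Icc (a i) (b i)} =
      ⋂ i, (fun x : Plane => x i) ⁻¹' Set.Icc (a i) (b i) := by
    ext x; simp
  rw [this]
  exact MeasurableSet.iInter fun i => measurableSet_Icc.preimage (by fun_prop)

theorem measurableSet_unitSquare : MeasurableSet unitSquare :=
  measurableSet_plane_box (fun _ => 0) (fun _ => 1)

instance isProbabilityMeasure_uniformSquare : IsProbabilityMeasure uniformSquare := by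
  refine ⟨?_⟩
  rw [uniformSquare, Measure.restrict_apply_univ]
  have := volume_plane_box (fun _ => 0) (fun _ => 1)
  simpa [unitSquare] using this

theorem uniformSquare_ball_le (p : Plane) {r : ℝ} (hr : 0 ≤ r) :
    uniformSquare {q | dist q p < r} ≤ ENNReal.ofReal (4 * r ^ 2) := by
  calc uniformSquare {q | dist q p < r} ≤ volume (Metric.ball p r) := Measure.restrict_apply_le _ _
    _ = ENNReal.ofReal (r ^ 2 * Real.pi) := by
        rw [EuclideanSpace.volume_ball_fin_two, ENNReal.ofReal_mul (by positivity),
          ENNReal.ofReal_pow hr]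
    _ ≤ _ := ENNReal.ofReal_le_ofReal (by nlinarith [Real.pi_le_four, sq_nonneg r])

/-- The area is `π δ (2 - δ) r²`, linear in `δ`, which balances the factor `1/δ` in the packing
bound. -/
theorem uniformSquare_annulus_le (p : Plane) {r δ : ℝ} (hr : 0 ≤ r) (hδ0 : 0 ≤ δ) (hδ : δ ≤ 1) :
    uniformSquare {q | (1 - δ) * r ≤ dist q p ∧ dist q p < r} ≤
      ENNReal.ofReal (8 * δ * r ^ 2) := by
  have h0 : 0 ≤ (1 - δ) * r := mul_nonneg (by linarith) hr
  have hsub : Metric.ball p ((1 - δ) * r) ⊆ Metric.ball p r :=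
    Metric.ball_subset_ball (by nlinarith)
  calc uniformSquare {q | (1 - δ) * r ≤ dist q p ∧ dist q p < r}
      ≤ volume {q | (1 - δ) * r ≤ dist q p ∧ dist q p < r} := Measure.restrict_apply_le _ _
    _ = volume (Metric.ball p r \ Metric.ball p ((1 - δ) * r)) := by
        congr 1; ext q; simp [and_comm]
    _ = ENNReal.ofReal (r ^ 2 * Real.pi - ((1 - δ) * r) ^ 2 * Real.pi) := by
        rw [measure_sdiff hsub Metric.isOpen_ball.measurableSet.nullMeasurableSet
          measure_ball_lt_top.ne, EuclideanSpace.volume_ball_fin_two,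
          EuclideanSpace.volume_ball_fin_two, ENNReal.ofReal_sub _ (by positivity),
          ENNReal.ofReal_mul (sq_nonneg r), ENNReal.ofReal_mul (sq_nonneg _),
          ENNReal.ofReal_pow hr, ENNReal.ofReal_pow h0]
    _ ≤ _ := by
        refine ENNReal.ofReal_le_ofReal ?_
        have e : r ^ 2 * Real.pi - ((1 - δ) * r) ^ 2 * Real.pi =
          Real.pi * (δ * r ^ 2 * (2 - δ)) := by ring
        rw [e]
        have h1 : δ * r ^ 2 * (2 - δ) ≤ δ * r ^ 2 * 2 := by gcongr; linarith
        have h2 : 0 ≤ δ * r ^ 2 * (2 - δ) := mul_nonneg (by positivity) (by linarith)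
        nlinarith [Real.pi_le_four]

/-- Bounds for one pair of independent uniform users follow from bounds for one user. -/
theorem pi_uniform_pair_le {n : ℕ} {u v : Fin n} (huv : u ≠ v) {s : Set (Plane × Plane)}
    (hs : MeasurableSet s) {q : ENNReal} (h : ∀ p, uniformSquare {y | (y, p) ∈ s} ≤ q) :
    (Measure.pi fun _ : Fin n => uniformSquare) {x | (x u, x v) ∈ s} ≤ q := by
  -- Distinct coordinates are independent, so the pair has the product law and the bound can be
  -- integrated over the second point.
  have hind : IndepFun (fun x : Fin n → Plane => x u) (fun x => x v)
      (Measure.pi fun _ : Fin n => uniformSquare) :=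
    (iIndepFun_pi (μ := fun _ : Fin n => uniformSquare) (X := fun _ y => y)
      fun _ => aemeasurable_id).indepFun huv
  have hmap := (indepFun_iff_map_prod_eq_prod_map_map
    (measurable_pi_apply u).aemeasurable (measurable_pi_apply v).aemeasurable).1 hind
  have hu := (measurePreserving_eval (fun _ : Fin n => uniformSquare) u).map_eq
  have hv := (measurePreserving_eval (fun _ : Fin n => uniformSquare) v).map_eq
  rw [show (Function.eval u : (Fin n → Plane) → Plane) = fun x => x u from rfl] at hu
  rw [show (Function.eval v : (Fin n → Plane) → Plane) = fun x => x v from rfl] at hv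
  rw [hu, hv] at hmap
  calc _ = ((Measure.pi fun _ : Fin n => uniformSquare).map fun x => (x u, x v)) s := by
        rw [Measure.map_apply ((measurable_pi_apply u).prodMk (measurable_pi_apply v)) hs]; rfl
    _ = ∫⁻ p, uniformSquare {y | (y, p) ∈ s} ∂uniformSquare := by
        rw [hmap, Measure.prod_apply_symm hs]; rfl
    _ ≤ ∫⁻ _, q ∂uniformSquare := lintegral_mono h
    _ = q := by simp

end Uniform

/-! ### The upper bound with a free rank threshold and distance threshold. -/

section GeneralBound

variable {n m : ℕ}

theorem isProbabilityMeasure_networkLaw (γr : ℝ) (hm : 0 < m)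
    (κ : Kernel (Fin n → Plane) (Fin n → Fin m)) [IsMarkovKernel κ] :
    IsProbabilityMeasure (networkLaw γr n m κ) := by
  have := isProbabilityMeasure_zipf γr hm
  unfold networkLaw
  infer_instance

theorem ae_mem_unitSquare (γr : ℝ) (hm : 0 < m)
    (κ : Kernel (Fin n → Plane) (Fin n → Fin m)) [IsMarkovKernel κ] :
    ∀ᵐ ω ∂networkLaw γr n m κ, ∀ u, ω.1.1 u ∈ unitSquare := by
  have := isProbabilityMeasure_zipf γr hm
  have h1 : ∀ᵐ x ∂(Measure.pi fun _ : Fin n => uniformSquare), ∀ u, x u ∈ unitSquare := by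
    rw [ae_all_iff]
    intro u
    have : ∀ᵐ y ∂uniformSquare, y ∈ unitSquare := ae_restrict_mem measurableSet_unitSquare
    exact (measurePreserving_eval (fun _ : Fin n => uniformSquare) u).quasiMeasurePreserving.ae this
  have h2 : ∀ᵐ p ∂((Measure.pi fun _ : Fin n => uniformSquare) ⊗ₘ κ),
      ∀ u, p.1 u ∈ unitSquare := by
    have hq : Measure.QuasiMeasurePreserving Prod.fst
        ((Measure.pi fun _ : Fin n => uniformSquare) ⊗ₘ κ)
        (Measure.pi fun _ : Fin n => uniformSquare) := by
      refine ⟨measurable_fst, ?_⟩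
      have := Measure.fst_compProd (Measure.pi fun _ : Fin n => uniformSquare) κ
      rw [Measure.fst] at this
      rw [this]
    exact hq.ae h1
  exact Measure.quasiMeasurePreserving_fst.ae h2

theorem integrable_activeLinks (γr : ℝ) (hm : 0 < m) (r : ℝ)
    (κ : Kernel (Fin n → Plane) (Fin n → Fin m)) [IsMarkovKernel κ] :
    Integrable (fun ω => (activeLinks r ω.1.1 ω.1.2 ω.2 : ℝ)) (networkLaw γr n m κ) := by
  have := isProbabilityMeasure_networkLaw γr hm κ
  refine Integrable.of_bound (C := n) ?_ ?_
  · exact (measurable_from_top.comp (measurable_activeLinks r)).aestronglyMeasurable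
  · refine Eventually.of_forall fun ω => ?_
    simpa using activeLinks_le r ω.1.1 ω.1.2 ω.2

/-- The event that `u` caches a file of rank above `K` and its distance from `v` is in `[ρ, r)`. -/
def rareCacheEvent (ρ r K : ℝ) (u v : Fin n) : Set ((Fin n → Plane) × (Fin n → Fin m)) :=
  {p | ρ ≤ dist (p.1 u) (p.1 v) ∧ dist (p.1 u) (p.1 v) < r ∧ K < ((p.2 u : ℕ) : ℝ) + 1}

/-- The event that `v` requests a file of rank above `K`, which `u` caches at a distance in
`[ρ, r)` from `v`. -/
def rareServeEvent (ρ r K : ℝ) (u v : Fin n) :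
    Set (((Fin n → Plane) × (Fin n → Fin m)) × (Fin n → Fin m)) :=
  {ω | ω.1 ∈ rareCacheEvent ρ r K u v ∧ ω.1.2 u = ω.2 v}

/-- The event that `v` requests a file of rank at most `K`. -/
def popularEvent (K : ℝ) (v : Fin n) :
    Set (((Fin n → Plane) × (Fin n → Fin m)) × (Fin n → Fin m)) :=
  {ω | ((ω.2 v : ℕ) : ℝ) + 1 ≤ K}

theorem measurableSet_rareCacheEvent (ρ r K : ℝ) (u v : Fin n) :
    MeasurableSet (rareCacheEvent (m := m) ρ r K u v) := by
  have hd : Measurable fun p : (Fin n → Plane) × (Fin n → Fin m) => dist (p.1 u) (p.1 v) :=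
    ((measurable_pi_apply u).comp measurable_fst).dist ((measurable_pi_apply v).comp measurable_fst)
  have hc : Measurable fun p : (Fin n → Plane) × (Fin n → Fin m) => ((p.2 u : ℕ) : ℝ) + 1 :=
    (measurable_from_top (f := fun i : Fin m => ((i : ℕ) : ℝ) + 1)).comp
      ((measurable_pi_apply u).comp measurable_snd)
  exact (measurableSet_le measurable_const hd).inter
    ((measurableSet_lt hd measurable_const).inter (measurableSet_lt measurable_const hc))

theorem measurableSet_rareServeEvent (ρ r K : ℝ) (u v : Fin n) :
    MeasurableSet (rareServeEvent (m := m) ρ r K u v) :=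
  ((measurableSet_rareCacheEvent ρ r K u v).preimage measurable_fst).inter
    (measurableSet_eq_fun ((measurable_pi_apply u).comp (measurable_snd.comp measurable_fst))
      ((measurable_pi_apply v).comp measurable_snd))

theorem measurableSet_popularEvent (K : ℝ) (v : Fin n) :
    MeasurableSet (popularEvent (m := m) K v) :=
  (MeasurableSet.of_discrete (s := {z : Fin n → Fin m | ((z v : ℕ) : ℝ) + 1 ≤ K})).preimage
    measurable_snd

theorem networkLaw_popularEvent_le {γr : ℝ} (hγ0 : 0 ≤ γr) (hγ1 : γr < 1) (hm : 0 < m)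
    (κ : Kernel (Fin n → Plane) (Fin n → Fin m)) [IsMarkovKernel κ] {K : ℝ} (hK : 0 ≤ K)
    (v : Fin n) :
    networkLaw γr n m κ (popularEvent K v) ≤
      ENNReal.ofReal ((K / m) ^ (1 - γr) / (1 - γr)) := by
  classical
  have := isProbabilityMeasure_zipf γr hm
  have e : popularEvent (m := m) K v = Set.univ ×ˢ
      ((fun z : Fin n → Fin m => z v) ⁻¹' {i : Fin m | ((i : ℕ) : ℝ) + 1 ≤ K}) := by
    ext ω; simp [popularEvent]
  rw [e, networkLaw, Measure.prod_prod, measure_univ, one_mul]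
  have h := (measurePreserving_eval (fun _ : Fin n => zipf γr m) v).measure_preimage
    (s := {i : Fin m | ((i : ℕ) : ℝ) + 1 ≤ K}) MeasurableSet.of_discrete.nullMeasurableSet
  refine h.le.trans ?_
  rw [zipf_apply]
  refine ENNReal.ofReal_le_ofReal ?_
  simpa using sum_zipfProb_rank_le hγ0 hγ1 hm hK

/-- Given positions and caches, the request of `v` is still Zipf and must equal one determined file
of rank above `K`. This is where ignorance of the requests limits the policy. -/
theorem networkLaw_rareServeEvent_le {γr : ℝ} (hγ0 : 0 ≤ γr) (hm : 0 < m)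
    (κ : Kernel (Fin n → Plane) (Fin n → Fin m)) [IsMarkovKernel κ] {K : ℝ} (hK : 0 < K)
    (ρ r : ℝ) (u v : Fin n) :
    networkLaw γr n m κ (rareServeEvent ρ r K u v) ≤
      ((Measure.pi fun _ : Fin n => uniformSquare) ⊗ₘ κ) (rareCacheEvent ρ r K u v) *
      ENNReal.ofReal (1 / (K ^ γr * (m : ℝ) ^ (1 - γr))) := by
  have := isProbabilityMeasure_zipf γr hm
  rw [networkLaw, Measure.prod_apply (measurableSet_rareServeEvent ρ r K u v), mul_comm,
    ← setLIntegral_const, ← lintegral_indicator (measurableSet_rareCacheEvent ρ r K u v)]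
  refine lintegral_mono fun p => ?_
  by_cases hp : p ∈ rareCacheEvent ρ r K u v
  · rw [Set.indicator_of_mem hp]
    have h := (measurePreserving_eval (fun _ : Fin n => zipf γr m) v).measure_preimage
      (s := {p.2 u}) MeasurableSet.of_discrete.nullMeasurableSet
    calc _ ≤ (Measure.pi fun _ : Fin n => zipf γr m) (Function.eval v ⁻¹' {p.2 u}) := by
          refine measure_mono fun z hz => ?_
          exact hz.2.symm
      _ = ENNReal.ofReal (zipfProb γr m (p.2 u)) := by rw [h, zipf_singleton]
      _ ≤ _ := ENNReal.ofReal_le_ofReal (zipfProb_le_of_lt_rank hγ0 hm hK hp.2.2)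
  · rw [Set.indicator_of_notMem hp]
    have : Prod.mk p ⁻¹' rareServeEvent (m := m) ρ r K u v = ∅ := by
      ext z
      simp only [Set.mem_preimage, Set.mem_empty_iff_false, iff_false]
      exact fun hz => hp hz.1
    simp [this]

open Classical in
-- A served receiver either makes a popular request or is served a rare one by some other user; the
-- latter is bounded by a union over users.
theorem card_isServed_le (ρ r K : ℝ)
    (ω : ((Fin n → Plane) × (Fin n → Fin m)) × (Fin n → Fin m)) :
    ((Finset.univ.filter (IsServed ρ r ω.1.1 ω.1.2 ω.2)).card : ENNReal) ≤
      ∑ v, ((popularEvent K v).indicator 1 ω +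
        ∑ u ∈ Finset.univ.erase v, (rareServeEvent ρ r K u v).indicator 1 ω) := by
  rw [Finset.card_filter]
  push_cast
  refine Finset.sum_le_sum fun v _ => ?_
  split_ifs with h
  · obtain ⟨u, huv, h1, h2, h3⟩ := h
    by_cases hp : ω ∈ popularEvent K v
    · rw [Set.indicator_of_mem hp]
      exact le_self_add
    · refine le_trans ?_ le_add_self
      have hmem : ω ∈ rareServeEvent ρ r K u v := by
        refine ⟨⟨h1, h2, ?_⟩, h3⟩
        rw [h3]
        exact not_le.1 hp
      refine le_trans ?_ (Finset.single_le_sum (fun _ _ => zero_le)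
        (Finset.mem_erase.2 ⟨huv, Finset.mem_univ u⟩))
      rw [Set.indicator_of_mem hmem]
      rfl
  · exact zero_le

/-- Upper bound for a general caching policy: links shorter than `ρ` are counted by `b`; the
receivers of the others are split by the rank `K` of their requests. -/
theorem expectedActiveLinks_le_general {γr : ℝ} (hγ0 : 0 ≤ γr) (hγ1 : γr < 1) (hm : 0 < m)
    (κ : Kernel (Fin n → Plane) (Fin n → Fin m)) [IsMarkovKernel κ] {K : ℝ} (hK : 0 < K)
    {r r' ρ b q : ℝ} (hb0 : 0 ≤ b) (hq0 : 0 ≤ q)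
    (hb : ∀ (x : Fin n → Plane) (c z : Fin n → Fin m) (S : Finset (Fin n × Fin n)),
      (∀ u, x u ∈ unitSquare) → IsSchedule r x c z S → IsSchedule r' x c z S ∧
      ((S.filter fun l => dist (x l.1) (x l.2) < ρ).card : ℝ) ≤ b)
    (hq : ∀ u v : Fin n, u ≠ v → ((Measure.pi fun _ : Fin n => uniformSquare) ⊗ₘ κ)
      (rareCacheEvent ρ r' K u v) ≤ ENNReal.ofReal q) :
    expectedActiveLinks γr n m r κ ≤ b + n * ((K / m) ^ (1 - γr) / (1 - γr) +
      n * (q * (1 / (K ^ γr * (m : ℝ) ^ (1 - γr))))) := by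
  classical
  have := isProbabilityMeasure_networkLaw γr hm κ
  have ha : 0 < 1 - γr := by linarith
  have hA0 : 0 ≤ (K / m) ^ (1 - γr) / (1 - γr) := by positivity
  have hB0 : 0 ≤ q * (1 / (K ^ γr * (m : ℝ) ^ (1 - γr))) := by positivity
  have hA := networkLaw_popularEvent_le (n := n) hγ0 hγ1 hm κ hK.le
  have hB : ∀ u v : Fin n, u ≠ v → networkLaw γr n m κ (rareServeEvent ρ r' K u v) ≤
      ENNReal.ofReal (q * (1 / (K ^ γr * (m : ℝ) ^ (1 - γr)))) := by
    intro u v huv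
    rw [ENNReal.ofReal_mul hq0]
    refine (networkLaw_rareServeEvent_le hγ0 hm κ hK ρ r' u v).trans ?_
    gcongr
    exact hq u v huv
  generalize (K / m) ^ (1 - γr) / (1 - γr) = A at *
  generalize q * (1 / (K ^ γr * (m : ℝ) ^ (1 - γr))) = B at *
  have hae : ∀ᵐ ω ∂networkLaw γr n m κ,
      ENNReal.ofReal (activeLinks r ω.1.1 ω.1.2 ω.2 : ℝ) ≤ ENNReal.ofReal b +
        ∑ v, ((popularEvent K v).indicator 1 ω +
          ∑ u ∈ Finset.univ.erase v, (rareServeEvent ρ r' K u v).indicator 1 ω) := by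
    filter_upwards [ae_mem_unitSquare γr hm κ] with ω hω
    obtain ⟨S, hS, hc⟩ := exists_isSchedule_card_eq r ω.1.1 ω.1.2 ω.2
    obtain ⟨hS', hSb⟩ := hb _ _ _ S hω hS
    have h := hS'.card_le (ρ := ρ)
    rw [← hc]
    calc ENNReal.ofReal (S.card : ℝ)
        ≤ ENNReal.ofReal (((S.filter fun l => dist (ω.1.1 l.1) (ω.1.1 l.2) < ρ).card : ℝ) +
          ((Finset.univ.filter (IsServed ρ r' ω.1.1 ω.1.2 ω.2)).card : ℝ)) :=
          ENNReal.ofReal_le_ofReal (by exact_mod_cast h)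
      _ ≤ ENNReal.ofReal b +
          ((Finset.univ.filter (IsServed ρ r' ω.1.1 ω.1.2 ω.2)).card : ENNReal) := by
          rw [ENNReal.ofReal_add (by positivity) (by positivity), ENNReal.ofReal_natCast (n := Finset.card (Finset.univ.filter _))]
          gcongr
      _ ≤ _ := by gcongr; exact card_isServed_le ρ r' K ω
  have hlin : ∫⁻ ω, ENNReal.ofReal (activeLinks r ω.1.1 ω.1.2 ω.2 : ℝ) ∂networkLaw γr n m κ ≤
      ENNReal.ofReal (b + n * (A + n * B)) := by
    calc _ ≤ ∫⁻ ω, (ENNReal.ofReal b + ∑ v, ((popularEvent K v).indicator 1 ω +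
          ∑ u ∈ Finset.univ.erase v, (rareServeEvent ρ r' K u v).indicator 1 ω))
            ∂networkLaw γr n m κ := lintegral_mono_ae hae
      _ = ENNReal.ofReal b + ∑ v, (networkLaw γr n m κ (popularEvent K v) +
          ∑ u ∈ Finset.univ.erase v, networkLaw γr n m κ (rareServeEvent ρ r' K u v)) := by
          have hm1 : ∀ v : Fin n, Measurable ((popularEvent (m := m) K v).indicator
              (1 : ((Fin n → Plane) × (Fin n → Fin m)) × (Fin n → Fin m) → ENNReal)) := fun v =>
            measurable_one.indicator (measurableSet_popularEvent K v)
          have hm2 : ∀ u v : Fin n, Measurable ((rareServeEvent (m := m) ρ r' K u v).indicator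
              (1 : ((Fin n → Plane) × (Fin n → Fin m)) × (Fin n → Fin m) → ENNReal)) := fun u v =>
            measurable_one.indicator (measurableSet_rareServeEvent ρ r' K u v)
          have hm3 : ∀ v : Fin n, Measurable fun ω =>
              ((popularEvent (m := m) K v).indicator 1 ω : ENNReal) +
                ∑ u ∈ Finset.univ.erase v, (rareServeEvent ρ r' K u v).indicator 1 ω := fun v =>
            (hm1 v).add (Finset.measurable_fun_sum _ fun u _ => hm2 u v)
          rw [lintegral_add_left measurable_const, lintegral_const, measure_univ, mul_one,
            lintegral_finsetSum _ fun v _ => hm3 v]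
          congr 1
          refine Finset.sum_congr rfl fun v _ => ?_
          rw [lintegral_add_left (hm1 v), lintegral_indicator_one (measurableSet_popularEvent K v),
            lintegral_finsetSum _ fun u _ => hm2 u v]
          congr 1
          exact Finset.sum_congr rfl fun u _ =>
            lintegral_indicator_one (measurableSet_rareServeEvent ρ r' K u v)
      _ ≤ ENNReal.ofReal b + ∑ _v : Fin n, (ENNReal.ofReal A + ∑ _u : Fin n, ENNReal.ofReal B) := by
          gcongr with v _
          · exact hA v
          · refine le_trans (Finset.sum_le_sum fun u hu => ?_)
              (Finset.sum_le_sum_of_subset (Finset.subset_univ (Finset.univ.erase v)))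
            exact hB u v (Finset.ne_of_mem_erase hu)
      _ = _ := by
          rw [Finset.sum_const, Finset.sum_const, Finset.card_univ, Fintype.card_fin,
            nsmul_eq_mul, nsmul_eq_mul, ENNReal.ofReal_add hb0 (by positivity),
            ENNReal.ofReal_mul (by positivity), ENNReal.ofReal_add hA0 (by positivity),
            ENNReal.ofReal_mul (by positivity), ENNReal.ofReal_natCast]
  rw [expectedActiveLinks, integral_eq_lintegral_of_nonneg_ae
    (Eventually.of_forall fun _ => Nat.cast_nonneg _)
    (integrable_activeLinks γr hm r κ).aestronglyMeasurable]
  exact ENNReal.toReal_le_of_le_ofReal (by positivity) hlin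

end GeneralBound

/-! ### The upper bound for arbitrary policies. -/

theorem dist_lt_two {p q : Plane} (hp : p ∈ unitSquare) (hq : q ∈ unitSquare) : dist p q < 2 := by
  refine lt_of_pow_lt_pow_left₀ 2 (by norm_num) ?_
  rw [dist_sq_plane]
  have h0 := hp 0
  have h1 := hp 1
  have g0 := hq 0
  have g1 := hq 1
  simp only [Set.mem_Icc] at h0 h1 g0 g1
  nlinarith

/-- Users of the unit square are always closer than 2, so a larger range can be capped at 2, as the
packing bound requires. -/
theorem IsSchedule.min_two {n m : ℕ} {r : ℝ} {x : Fin n → Plane} {c z : Fin n → Fin m}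
    {S : Finset (Fin n × Fin n)} (hS : IsSchedule r x c z S) (hx : ∀ u, x u ∈ unitSquare) :
    IsSchedule (min r 2) x c z S :=
  ⟨fun l hl => ⟨(hS.1 l hl).1, lt_min (hS.1 l hl).2.1 (dist_lt_two (hx _) (hx _)),
    (hS.1 l hl).2.2⟩, fun k hk l hl h => (min_le_left _ _).trans_lt (hS.2 k hk l hl h)⟩

theorem expectedActiveLinks_of_nonpos {n m : ℕ} {γr r : ℝ} (hr : r ≤ 0)
    (κ : Kernel (Fin n → Plane) (Fin n → Fin m)) : expectedActiveLinks γr n m r κ = 0 := by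
  have h : ∀ (x : Fin n → Plane) (c z : Fin n → Fin m), activeLinks r x c z = 0 := by
    intro x c z
    obtain ⟨S, hS, hc⟩ := exists_isSchedule_card_eq r x c z
    rw [← hc, Finset.card_eq_zero, Finset.eq_empty_iff_forall_notMem]
    intro l hl
    exact absurd ((hS.1 l hl).2.1.trans_le hr) (not_lt.2 dist_nonneg)
  simp [expectedActiveLinks, h]

/-- With an empty library and at least one user there are no cache configurations, so no probability
kernel. -/
theorem library_pos {n m : ℕ} (hn : 0 < n) (κ : Kernel (Fin n → Plane) (Fin n → Fin m))
    [IsMarkovKernel κ] : 0 < m := by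
  by_contra hm
  obtain rfl : m = 0 := by omega
  have : IsEmpty (Fin n → Fin 0) := ⟨fun f => (f ⟨0, hn⟩).elim0⟩
  have h := measure_univ (μ := κ fun _ => 0)
  rw [Set.univ_eq_empty_iff.2 this, measure_empty] at h
  exact zero_ne_one h

/-- The policy may correlate caches with positions, so the cache condition is discarded; the
position marginal remains uniform. -/
theorem compProd_rareCacheEvent_le {n m : ℕ} (κ : Kernel (Fin n → Plane) (Fin n → Fin m))
    [IsMarkovKernel κ] {r δ : ℝ} (hr : 0 ≤ r) (hδ0 : 0 ≤ δ) (hδ : δ ≤ 1) (K : ℝ) {u v : Fin n}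
    (huv : u ≠ v) :
    ((Measure.pi fun _ : Fin n => uniformSquare) ⊗ₘ κ)
      (rareCacheEvent ((1 - δ) * r) r K u v) ≤ ENNReal.ofReal (8 * δ * r ^ 2) := by
  have hms : MeasurableSet {p : Plane × Plane | (1 - δ) * r ≤ dist p.1 p.2 ∧ dist p.1 p.2 < r} :=
    (measurableSet_le measurable_const (measurable_fst.dist measurable_snd)).inter
      (measurableSet_lt (measurable_fst.dist measurable_snd) measurable_const)
  have hmx : MeasurableSet {x : Fin n → Plane | (x u, x v) ∈
      {p : Plane × Plane | (1 - δ) * r ≤ dist p.1 p.2 ∧ dist p.1 p.2 < r}} :=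
    hms.preimage ((measurable_pi_apply u).prodMk (measurable_pi_apply v))
  refine le_trans ?_ (pi_uniform_pair_le huv hms fun p => uniformSquare_annulus_le p hr hδ0 hδ)
  have e := Measure.fst_apply (ρ := (Measure.pi fun _ : Fin n => uniformSquare) ⊗ₘ κ) hmx
  rw [Measure.fst_compProd] at e
  rw [e]
  refine measure_mono ?_
  rintro p ⟨h1, h2, -⟩
  exact ⟨h1, h2⟩

/-- The upper bound: the expected number of active links is at most of order `n / m ^ η`. -/
theorem expectedActiveLinks_le_of_any_policy {γr : ℝ} (hγ0 : 0 ≤ γr) (hγ1 : γr < 1) {n m : ℕ}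
    (r : ℝ) (κ : Kernel (Fin n → Plane) (Fin n → Fin m)) [IsMarkovKernel κ] :
    expectedActiveLinks γr n m r κ ≤
      (152 + 1 / (1 - γr)) * ((n : ℝ) / (m : ℝ) ^ eta γr) := by
  have ha : 0 < 1 - γr := by linarith
  rcases Nat.eq_zero_or_pos n with rfl | hn
  · have h : ∀ (x : Fin 0 → Plane) (c z : Fin 0 → Fin m), activeLinks r x c z = 0 :=
      fun x c z => Nat.le_zero.1 (activeLinks_le r x c z)
    simp [expectedActiveLinks, h]
  rcases le_or_gt r 0 with hr | hr
  · rw [expectedActiveLinks_of_nonpos hr]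
    positivity
  have hm := library_pos hn κ
  have hn' : (0 : ℝ) < n := by exact_mod_cast hn
  have hm' : (0 : ℝ) < m := by exact_mod_cast hm
  -- The equation defining `η`: it says `(K / m) ^ (1 - γr) = 1 / K` for `K = m ^ η`.
  have hη : (eta γr - 1) * (1 - γr) = -eta γr := by
    have : 2 - γr ≠ 0 := by linarith
    unfold eta; field_simp; ring
  set K : ℝ := (m : ℝ) ^ eta γr with hKdef
  have hK : 0 < K := by positivity
  set s : ℝ := min r 2 with hs
  have hs0 : 0 < s := lt_min hr (by norm_num)
  -- This `δ` balances `1 / (δ s²)` short links against `n / K`. When it is capped at 1, the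
  -- threshold `(1 - δ) s` is 0 and no link is short.
  set δ : ℝ := min 1 (K / (n * s ^ 2)) with hδ
  have hδ0 : 0 < δ := lt_min one_pos (by positivity)
  have hδ1 : δ ≤ 1 := min_le_left _ _
  have hδK : n * (δ * s ^ 2) ≤ K := by
    have := min_le_right 1 (K / (n * s ^ 2))
    rw [← hδ, le_div_iff₀ (by positivity)] at this
    linarith
  have hmain := expectedActiveLinks_le_general (r := r) (r' := s) (ρ := (1 - δ) * s)
    (b := 144 * (n / K)) (q := 8 * δ * s ^ 2) hγ0 hγ1 hm κ hK (by positivity) (by positivity)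
    (by
      intro x c z S hx hS
      have hS' := hS.min_two hx
      refine ⟨hS', ?_⟩
      rcases le_or_gt 1 (K / (n * s ^ 2)) with h1 | h1
      · have hδe : δ = 1 := min_eq_left h1
        have : S.filter (fun l => dist (x l.1) (x l.2) < (1 - δ) * s) = ∅ := by
          refine Finset.filter_eq_empty_iff.2 fun l _ => ?_
          rw [hδe, sub_self, zero_mul, not_lt]
          exact dist_nonneg
        rw [this]
        simp only [Finset.card_empty, Nat.cast_zero]
        positivity
      · have hδe : δ = K / (n * s ^ 2) := min_eq_right h1.le
        have hS2 : IsSchedule s x c z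
            (S.filter fun l => dist (x l.1) (x l.2) < (1 - δ) * s) :=
          ⟨fun l hl => hS'.1 l (Finset.mem_filter.1 hl).1, fun k hk l hl =>
            hS'.2 k (Finset.mem_filter.1 hk).1 l (Finset.mem_filter.1 hl).1⟩
        refine (card_short_links_le hs0 (min_le_right _ _) hδ0 hδ1 hx hS2
          fun l hl => (Finset.mem_filter.1 hl).2).trans (le_of_eq ?_)
        rw [hδe]
        field_simp)
    (fun u v huv => compProd_rareCacheEvent_le κ hs0.le hδ0.le hδ1 K huv)
  refine hmain.trans ?_
  have hKm : (K / m) ^ (1 - γr) = K⁻¹ := by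
    rw [hKdef, ← Real.rpow_sub_one hm'.ne', ← Real.rpow_mul hm'.le, hη, Real.rpow_neg hm'.le]
  have hKm2 : K * (1 / (K ^ γr * (m : ℝ) ^ (1 - γr))) = K⁻¹ := by
    rw [← hKm, Real.div_rpow hK.le hm'.le, Real.rpow_sub hK, Real.rpow_one]
    field_simp
  have hlast : n * (8 * δ * s ^ 2 * (1 / (K ^ γr * (m : ℝ) ^ (1 - γr)))) ≤ 8 * K⁻¹ := by
    calc _ = 8 * ((n * (δ * s ^ 2)) * (1 / (K ^ γr * (m : ℝ) ^ (1 - γr)))) := by ring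
      _ ≤ 8 * (K * (1 / (K ^ γr * (m : ℝ) ^ (1 - γr)))) := by gcongr
      _ = _ := by rw [hKm2]
  calc _ ≤ 144 * (n / K) + n * (K⁻¹ / (1 - γr) + 8 * K⁻¹) := by
        rw [hKm]; gcongr
    _ = _ := by field_simp; ring

/-! ### The upper bound for independent Zipf caching. -/

instance isMarkovKernel_zipfCaching (γc : ℝ) (n m : ℕ) [NeZero m] :
    IsMarkovKernel (zipfCaching γc n m) := by
  have := isProbabilityMeasure_zipf γc (NeZero.pos m)
  unfold zipfCaching
  infer_instance

theorem zipf_rank_gt_le {γc : ℝ} (hγc : 1 < γc) {m : ℕ} (hm : 0 < m) {K : ℝ} (hK : 1 ≤ K) :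
    zipf γc m {i | K < ((i : ℕ) : ℝ) + 1} ≤
      ENNReal.ofReal (2 ^ (γc - 1) / (γc - 1) * K ^ (1 - γc)) := by
  classical
  rw [zipf_apply]
  refine ENNReal.ofReal_le_ofReal ?_
  simp_rw [zipfProb_eq]
  rw [← Finset.sum_div]
  refine (div_le_self (Finset.sum_nonneg fun _ _ => by positivity) (one_le_zipfSum hm)).trans ?_
  simpa using sum_one_div_rpow_tail_le hγc m hK

/-- Here caches are independent of positions, so the probability factors into a disc area and a
caching tail. -/
theorem compProd_zipfCaching_rareCacheEvent_le {n m : ℕ} {γc : ℝ} (hγc : 1 < γc) (hm : 0 < m)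
    {r K : ℝ} (hr : 0 ≤ r) (hK : 1 ≤ K) {u v : Fin n} (huv : u ≠ v) :
    ((Measure.pi fun _ : Fin n => uniformSquare) ⊗ₘ zipfCaching γc n m)
      (rareCacheEvent 0 r K u v) ≤
      ENNReal.ofReal (4 * r ^ 2 * (2 ^ (γc - 1) / (γc - 1) * K ^ (1 - γc))) := by
  have := isProbabilityMeasure_zipf γc hm
  have hms : MeasurableSet {p : Plane × Plane | dist p.1 p.2 < r} :=
    measurableSet_lt (measurable_fst.dist measurable_snd) measurable_const
  rw [zipfCaching, Measure.compProd_const, ENNReal.ofReal_mul (by positivity)]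
  calc _ ≤ ((Measure.pi fun _ : Fin n => uniformSquare).prod (Measure.pi fun _ => zipf γc m))
        ({x | (x u, x v) ∈ {p : Plane × Plane | dist p.1 p.2 < r}} ×ˢ
          (Function.eval u ⁻¹' {i : Fin m | K < ((i : ℕ) : ℝ) + 1})) :=
        measure_mono fun p hp => ⟨hp.2.1, hp.2.2⟩
    _ ≤ _ := by
        rw [Measure.prod_prod, (measurePreserving_eval (fun _ : Fin n => zipf γc m)
          u).measure_preimage MeasurableSet.of_discrete.nullMeasurableSet]
        exact mul_le_mul' (pi_uniform_pair_le huv hms fun p => uniformSquare_ball_le p hr)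
          (zipf_rank_gt_le hγc hm hK)

/-- Upper bound for independent Zipf caching with `n r² = O(m ^ θ)`. -/
theorem expectedActiveLinks_zipfCaching_le {γr γc θ : ℝ} (hγ0 : 0 ≤ γr) (hγ1 : γr < 1)
    (hγc : 1 < γc) (hθ : (1 - γr) * γc / (1 - γr + γc) = θ) {n m : ℕ} (hm : 0 < m) {r D : ℝ}
    (hr : 0 ≤ r) (hD : n * r ^ 2 ≤ D * (m : ℝ) ^ θ) :
    expectedActiveLinks γr n m r (zipfCaching γc n m) ≤
      (1 / (1 - γr) + 4 * D * (2 ^ (γc - 1) / (γc - 1))) * ((n : ℝ) / (m : ℝ) ^ θ) := by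
  have : NeZero m := ⟨hm.ne'⟩
  have ha : 0 < 1 - γr := by linarith
  have hc1 : 0 < γc - 1 := by linarith
  have hm' : (0 : ℝ) < m := by exact_mod_cast hm
  have hm1 : (1 : ℝ) ≤ m := by exact_mod_cast hm
  have hac : 0 < 1 - γr + γc := by linarith
  have hθ0 : 0 < θ := by rw [← hθ]; positivity
  -- The rank at which the head term `(K / m) ^ (1 - γr)` equals `m ^ (-θ)`. As `K ^ γc = m ^ θ`,
  -- the tail term then has the same order. No distance threshold is needed: `ρ = 0`.
  set K : ℝ := (m : ℝ) ^ (θ / γc) with hKdef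
  have hK1 : 1 ≤ K := Real.one_le_rpow hm1 (by positivity)
  have hK : 0 < K := by linarith
  have hmain := expectedActiveLinks_le_general (r := r) (r' := r) (ρ := 0) (b := 0)
    (q := 4 * r ^ 2 * (2 ^ (γc - 1) / (γc - 1) * K ^ (1 - γc))) hγ0 hγ1 hm (zipfCaching γc n m)
    hK le_rfl (by positivity)
    (by
      intro x c z S hx hS
      refine ⟨hS, ?_⟩
      have : S.filter (fun l => dist (x l.1) (x l.2) < 0) = ∅ :=
        Finset.filter_eq_empty_iff.2 fun l _ => not_lt.2 dist_nonneg
      simp [this])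
    (fun u v huv => compProd_zipfCaching_rareCacheEvent_le hγc hm hr hK1 huv)
  refine hmain.trans ?_
  have hKc : K ^ γc = (m : ℝ) ^ θ := by
    rw [hKdef, ← Real.rpow_mul hm'.le, div_mul_cancel₀ _ (by linarith)]
  have hKm : (K / m) ^ (1 - γr) = ((m : ℝ) ^ θ)⁻¹ := by
    rw [hKdef, ← Real.rpow_sub_one hm'.ne', ← Real.rpow_mul hm'.le, ← Real.rpow_neg hm'.le]
    congr 1
    rw [← hθ]; field_simp; ring
  have hlast : n * (4 * r ^ 2 * (2 ^ (γc - 1) / (γc - 1) * K ^ (1 - γc)) *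
      (1 / (K ^ γr * (m : ℝ) ^ (1 - γr)))) ≤
      4 * D * (2 ^ (γc - 1) / (γc - 1)) * ((m : ℝ) ^ θ)⁻¹ := by
    calc _ = (n * r ^ 2) * (4 * (2 ^ (γc - 1) / (γc - 1)) * (K ^ (1 - γc) *
          (1 / (K ^ γr * (m : ℝ) ^ (1 - γr))))) := by ring
      _ ≤ (D * (m : ℝ) ^ θ) * (4 * (2 ^ (γc - 1) / (γc - 1)) * (K ^ (1 - γc) *
          (1 / (K ^ γr * (m : ℝ) ^ (1 - γr))))) := by gcongr
      _ = _ := by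
          rw [← hKm, ← hKc, Real.div_rpow hK.le hm'.le, Real.rpow_sub hK, Real.rpow_sub hK,
            Real.rpow_one]
          field_simp
  calc _ ≤ 0 + n * (((m : ℝ) ^ θ)⁻¹ / (1 - γr) +
        4 * D * (2 ^ (γc - 1) / (γc - 1)) * ((m : ℝ) ^ θ)⁻¹) := by
        rw [hKm]; gcongr
    _ = _ := by field_simp; ring

/-! ### A second moment bound for matches between two groups of independent users. -/

section SecondMoment

variable {n : ℕ} {T : Type*} {ι : Type*}

/-- The number of users of `A` whose data lie in `S`. -/
noncomputable def countIn (A : Finset (Fin n)) (S : Set T) (ω : Fin n → T) : ℝ :=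
  ∑ u ∈ A, S.indicator (fun _ => (1 : ℝ)) (ω u)

theorem countIn_nonneg (A : Finset (Fin n)) (S : Set T) (ω : Fin n → T) : 0 ≤ countIn A S ω :=
  Finset.sum_nonneg fun _ _ => Set.indicator_nonneg (fun _ _ => zero_le_one) _

theorem countIn_le (A : Finset (Fin n)) (S : Set T) (ω : Fin n → T) :
    countIn A S ω ≤ A.card := by
  calc countIn A S ω ≤ ∑ _u ∈ A, (1 : ℝ) :=
        Finset.sum_le_sum fun _ _ => Set.indicator_le_self' (fun _ _ => zero_le_one) _
    _ = _ := by simp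

theorem exists_mem_of_countIn_ne_zero {A : Finset (Fin n)} {S : Set T} {ω : Fin n → T}
    (h : countIn A S ω ≠ 0) : ∃ u ∈ A, ω u ∈ S := by
  obtain ⟨u, hu, h⟩ := Finset.exists_ne_zero_of_sum_ne_zero h
  exact ⟨u, hu, Set.mem_of_indicator_ne_zero h⟩

/-- Exhibits the count as a function of the data of `A` alone, the form needed by
`integral_mul_of_disjoint`. -/
theorem countIn_eq_restrict (A : Finset (Fin n)) (S : Set T) (ω : Fin n → T) :
    countIn A S ω = ∑ u : A, S.indicator (fun _ => (1 : ℝ)) (ω u) :=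
  (Finset.sum_coe_sort A fun u => S.indicator (fun _ => (1 : ℝ)) (ω u)).symm

variable [MeasurableSpace T]

theorem measurable_countIn (A : Finset (Fin n)) {S : Set T} (hS : MeasurableSet S) :
    Measurable (countIn A S) :=
  Finset.measurable_fun_sum _ fun u _ =>
    (measurable_const.indicator hS).comp (measurable_pi_apply u)

variable (τ : Measure T) [IsProbabilityMeasure τ]

theorem integrable_of_measurable_of_le {f : (Fin n → T) → ℝ} (hf : Measurable f) {C : ℝ}
    (h0 : ∀ ω, 0 ≤ f ω) (hC : ∀ ω, f ω ≤ C) : Integrable f (Measure.pi fun _ => τ) :=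
  Integrable.of_bound hf.aestronglyMeasurable C
    (Eventually.of_forall fun ω => by rw [Real.norm_of_nonneg (h0 ω)]; exact hC ω)

theorem integral_eval_indicator (u : Fin n) {S : Set T} (hS : MeasurableSet S) :
    ∫ ω, S.indicator (fun _ => (1 : ℝ)) (ω u) ∂(Measure.pi fun _ : Fin n => τ) = τ.real S := by
  have h := (measurePreserving_eval (fun _ : Fin n => τ) u)
  have h2 := integral_map (μ := Measure.pi fun _ : Fin n => τ) (φ := Function.eval u)
    (f := S.indicator fun _ => (1 : ℝ)) (measurable_pi_apply u).aemeasurable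
    (measurable_const.indicator hS).aestronglyMeasurable
  rw [h.map_eq, integral_indicator_const _ hS] at h2
  simpa using h2.symm

theorem integrable_eval_indicator (u : Fin n) {S : Set T} (hS : MeasurableSet S) :
    Integrable (fun ω : Fin n → T => S.indicator (fun _ => (1 : ℝ)) (ω u))
      (Measure.pi fun _ : Fin n => τ) :=
  integrable_of_measurable_of_le τ ((measurable_const.indicator hS).comp (measurable_pi_apply u))
    (C := 1) (fun _ => Set.indicator_nonneg (fun _ _ => zero_le_one) _)
    (fun _ => Set.indicator_le_self' (fun _ _ => zero_le_one) _)

theorem integral_countIn (A : Finset (Fin n)) {S : Set T} (hS : MeasurableSet S) :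
    ∫ ω, countIn A S ω ∂(Measure.pi fun _ : Fin n => τ) = A.card * τ.real S := by
  unfold countIn
  rw [integral_finsetSum _ fun u _ => integrable_eval_indicator τ u hS]
  simp [integral_eval_indicator τ _ hS]

theorem iIndepFun_eval :
    iIndepFun (fun (u : Fin n) (ω : Fin n → T) => ω u) (Measure.pi fun _ : Fin n => τ) :=
  iIndepFun_pi (μ := fun _ : Fin n => τ) (X := fun _ y => y) fun _ => aemeasurable_id

theorem integral_eval_indicator_mul {u v : Fin n} (huv : u ≠ v) {S S' : Set T}
    (hS : MeasurableSet S) (hS' : MeasurableSet S') :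
    ∫ ω, S.indicator (fun _ => (1 : ℝ)) (ω u) * S'.indicator (fun _ => (1 : ℝ)) (ω v)
      ∂(Measure.pi fun _ : Fin n => τ) = τ.real S * τ.real S' := by
  have hm : Measurable (S.indicator fun _ => (1 : ℝ)) := measurable_const.indicator hS
  have hm' : Measurable (S'.indicator fun _ => (1 : ℝ)) := measurable_const.indicator hS'
  have h := ((iIndepFun_eval τ).indepFun huv).comp hm hm'
  have h2 := h.integral_fun_mul_eq_mul_integral
    ((measurable_const.indicator hS).comp (measurable_pi_apply u)).aestronglyMeasurable
    ((measurable_const.indicator hS').comp (measurable_pi_apply v)).aestronglyMeasurable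
  simp only [Function.comp_apply] at h2
  rw [h2, integral_eval_indicator τ u hS, integral_eval_indicator τ v hS']

/-- Pairs of distinct users are independent. The diagonal contributes only for `i = j`, because the
sets are disjoint. -/
theorem integral_countIn_mul_le [DecidableEq ι] (A : Finset (Fin n)) {S : ι → Set T}
    (hS : ∀ i, MeasurableSet (S i)) (hd : Pairwise fun i j => Disjoint (S i) (S j)) (i j : ι) :
    ∫ ω, countIn A (S i) ω * countIn A (S j) ω ∂(Measure.pi fun _ : Fin n => τ) ≤
      (A.card * τ.real (S i)) * (A.card * τ.real (S j)) +
        if i = j then A.card * τ.real (S i) else 0 := by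
  have hint : ∀ u v : Fin n, Integrable (fun ω : Fin n → T => (S i).indicator (fun _ => (1 : ℝ))
      (ω u) * (S j).indicator (fun _ => (1 : ℝ)) (ω v)) (Measure.pi fun _ : Fin n => τ) := by
    intro u v
    refine integrable_of_measurable_of_le τ
      (((measurable_const.indicator (hS i)).comp (measurable_pi_apply u)).mul
        ((measurable_const.indicator (hS j)).comp (measurable_pi_apply v))) (C := 1 * 1)
      (fun _ => mul_nonneg (Set.indicator_nonneg (fun _ _ => zero_le_one) _)
        (Set.indicator_nonneg (fun _ _ => zero_le_one) _))
      (fun _ => mul_le_mul (Set.indicator_le_self' (fun _ _ => zero_le_one) _)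
        (Set.indicator_le_self' (fun _ _ => zero_le_one) _)
        (Set.indicator_nonneg (fun _ _ => zero_le_one) _) zero_le_one)
  have hterm : ∀ u v : Fin n, ∫ ω, (S i).indicator (fun _ => (1 : ℝ)) (ω u) *
      (S j).indicator (fun _ => (1 : ℝ)) (ω v) ∂(Measure.pi fun _ : Fin n => τ) ≤
      τ.real (S i) * τ.real (S j) + if u = v then (if i = j then τ.real (S i) else 0) else 0 := by
    intro u v
    by_cases huv : u = v
    · subst huv
      rw [if_pos rfl]
      refine le_trans ?_ (le_add_of_nonneg_left (by positivity))
      split_ifs with hij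
      · subst hij
        rw [← integral_eval_indicator τ u (hS i)]
        refine le_of_eq (integral_congr_ae (Eventually.of_forall fun ω => ?_))
        by_cases h : ω u ∈ S i <;> simp [h]
      · refine le_of_eq (integral_eq_zero_of_ae (Eventually.of_forall fun ω => ?_))
        by_cases h : ω u ∈ S i
        · have h' : ω u ∉ S j := fun h' => Set.disjoint_left.1 (hd hij) h h'
          simp [h']
        · simp [h]
    · rw [if_neg huv, add_zero, integral_eval_indicator_mul τ huv (hS i) (hS j)]
  unfold countIn
  simp_rw [Finset.sum_mul_sum]
  rw [integral_finsetSum _ fun u _ => integrable_finsetSum _ fun v _ => hint u v]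
  calc _ = ∑ u ∈ A, ∑ v ∈ A, ∫ ω, (S i).indicator (fun _ => (1 : ℝ)) (ω u) *
      (S j).indicator (fun _ => (1 : ℝ)) (ω v) ∂(Measure.pi fun _ : Fin n => τ) :=
        Finset.sum_congr rfl fun u _ => integral_finsetSum _ fun v _ => hint u v
    _ ≤ ∑ u ∈ A, ∑ v ∈ A, (τ.real (S i) * τ.real (S j) +
        if u = v then (if i = j then τ.real (S i) else 0) else 0) :=
        Finset.sum_le_sum fun u _ => Finset.sum_le_sum fun v _ => hterm u v
    _ = _ := by
        simp only [Finset.sum_add_distrib, Finset.sum_ite_eq, Finset.sum_const, nsmul_eq_mul,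
          Finset.sum_ite_mem, Finset.inter_self]
        split_ifs <;> ring

theorem integral_mul_of_disjoint {A B : Finset (Fin n)} (hAB : Disjoint A B)
    {f : ((u : A) → T) → ℝ} {g : ((v : B) → T) → ℝ} (hf : Measurable f) (hg : Measurable g) :
    ∫ ω, f (fun u => ω u) * g (fun v => ω v) ∂(Measure.pi fun _ : Fin n => τ) =
      (∫ ω, f (fun u => ω u) ∂(Measure.pi fun _ : Fin n => τ)) *
        ∫ ω, g (fun v => ω v) ∂(Measure.pi fun _ : Fin n => τ) := by
  have h := ((iIndepFun_eval (n := n) τ).indepFun_finset A B hAB measurable_pi_apply).comp hf hg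
  exact h.integral_fun_mul_eq_mul_integral
    (hf.comp (measurable_pi_lambda _ fun u => measurable_pi_apply _)).aestronglyMeasurable
    (hg.comp (measurable_pi_lambda _ fun u => measurable_pi_apply _)).aestronglyMeasurable

theorem measurable_restrict_count (A : Finset (Fin n)) {S : Set T} (hS : MeasurableSet S) :
    Measurable fun a : (u : A) → T => ∑ u : A, S.indicator (fun _ => (1 : ℝ)) (a u) :=
  Finset.measurable_fun_sum _ fun u _ =>
    (measurable_const.indicator hS).comp (measurable_pi_apply u)

/-- Second moment bound: the probability that some user of `A` and some user of `B` match. -/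
theorem le_measureReal_exists_match {A B : Finset (Fin n)} (hAB : Disjoint A B) (I : Finset ι)
    {S S' : ι → Set T} (hS : ∀ i, MeasurableSet (S i)) (hS' : ∀ i, MeasurableSet (S' i))
    (hd : Pairwise fun i j => Disjoint (S i) (S j))
    (hd' : Pairwise fun i j => Disjoint (S' i) (S' j)) {a b : ℝ} (ha0 : 0 ≤ a) (hb0 : 0 ≤ b)
    (ha : ∀ i ∈ I, A.card * τ.real (S i) ≤ a) (hb : ∀ i ∈ I, B.card * τ.real (S' i) ≤ b)
    {M : ℝ} (hM : M = ∑ i ∈ I, (A.card * τ.real (S i)) * (B.card * τ.real (S' i))) :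
    M / (M + (1 + a + b)) ≤ (Measure.pi fun _ : Fin n => τ).real
      {ω | ∃ i ∈ I, ∃ u ∈ A, ∃ v ∈ B, ω u ∈ S i ∧ ω v ∈ S' i} := by
  classical
  set μ := Measure.pi fun _ : Fin n => τ with hμ
  set E : Set (Fin n → T) := {ω | ∃ i ∈ I, ∃ u ∈ A, ∃ v ∈ B, ω u ∈ S i ∧ ω v ∈ S' i} with hE
  have hEm : MeasurableSet E := by
    have : E = ⋃ i ∈ I, ⋃ u ∈ A, ⋃ v ∈ B, {ω | ω u ∈ S i} ∩ {ω | ω v ∈ S' i} := by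
      ext ω
      simp only [hE, Set.mem_ofPred_eq, Set.mem_iUnion, Set.mem_inter_iff, exists_prop]
    rw [this]
    exact Finset.measurableSet_biUnion _ fun i _ => Finset.measurableSet_biUnion _ fun u _ =>
      Finset.measurableSet_biUnion _ fun v _ => ((hS i).preimage (measurable_pi_apply u)).inter
        ((hS' i).preimage (measurable_pi_apply v))
  -- `X` counts matching pairs; `A` and `B` are disjoint, so their counts are independent.
  set X : (Fin n → T) → ℝ := fun ω => ∑ i ∈ I, countIn A (S i) ω * countIn B (S' i) ω with hX
  have hint1 : ∀ i, Integrable (fun ω => countIn A (S i) ω * countIn B (S' i) ω) μ := fun i =>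
    integrable_of_measurable_of_le τ ((measurable_countIn A (hS i)).mul
      (measurable_countIn B (hS' i))) (C := A.card * B.card)
      (fun ω => mul_nonneg (countIn_nonneg _ _ _) (countIn_nonneg _ _ _))
      (fun ω => mul_le_mul (countIn_le _ _ _) (countIn_le _ _ _) (countIn_nonneg _ _ _)
        (Nat.cast_nonneg _))
  have hint2 : ∀ i j, Integrable (fun ω => (countIn A (S i) ω * countIn A (S j) ω) *
      (countIn B (S' i) ω * countIn B (S' j) ω)) μ := fun i j =>
    integrable_of_measurable_of_le τ (((measurable_countIn A (hS i)).mul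
      (measurable_countIn A (hS j))).mul ((measurable_countIn B (hS' i)).mul
      (measurable_countIn B (hS' j)))) (C := (A.card * A.card) * (B.card * B.card))
      (fun ω => mul_nonneg (mul_nonneg (countIn_nonneg _ _ _) (countIn_nonneg _ _ _))
        (mul_nonneg (countIn_nonneg _ _ _) (countIn_nonneg _ _ _)))
      (fun ω => mul_le_mul (mul_le_mul (countIn_le _ _ _) (countIn_le _ _ _)
        (countIn_nonneg _ _ _) (Nat.cast_nonneg _)) (mul_le_mul (countIn_le _ _ _)
        (countIn_le _ _ _) (countIn_nonneg _ _ _) (Nat.cast_nonneg _))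
        (mul_nonneg (countIn_nonneg _ _ _) (countIn_nonneg _ _ _)) (by positivity))
  have hX1 : ∫ ω, X ω ∂μ = M := by
    rw [hX, hM, integral_finsetSum _ fun i _ => hint1 i]
    refine Finset.sum_congr rfl fun i _ => ?_
    simp_rw [countIn_eq_restrict]
    rw [hμ, integral_mul_of_disjoint τ hAB (measurable_restrict_count A (hS i))
      (measurable_restrict_count B (hS' i))]
    simp_rw [← countIn_eq_restrict]
    rw [integral_countIn τ A (hS i), integral_countIn τ B (hS' i)]
  have hXsq : ∀ ω, X ω ^ 2 = ∑ i ∈ I, ∑ j ∈ I, (countIn A (S i) ω * countIn A (S j) ω) *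
      (countIn B (S' i) ω * countIn B (S' j) ω) := by
    intro ω
    rw [hX, sq, Finset.sum_mul_sum]
    exact Finset.sum_congr rfl fun i _ => Finset.sum_congr rfl fun j _ => by ring
  have hM0 : 0 ≤ M := by rw [hM]; positivity
  have hX2 : ∫ ω, X ω ^ 2 ∂μ ≤ M ^ 2 + M * (1 + a + b) := by
    simp_rw [hXsq]
    rw [integral_finsetSum _ fun i _ => integrable_finsetSum _ fun j _ => hint2 i j]
    set α : ι → ℝ := fun i => A.card * τ.real (S i) with hα
    set β : ι → ℝ := fun i => B.card * τ.real (S' i) with hβ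
    have hα0 : ∀ i, 0 ≤ α i := fun i => by positivity
    have hβ0 : ∀ i, 0 ≤ β i := fun i => by positivity
    calc _ = ∑ i ∈ I, ∑ j ∈ I, (∫ ω, countIn A (S i) ω * countIn A (S j) ω ∂μ) *
          ∫ ω, countIn B (S' i) ω * countIn B (S' j) ω ∂μ := by
          refine Finset.sum_congr rfl fun i _ => ?_
          rw [integral_finsetSum _ fun j _ => hint2 i j]
          refine Finset.sum_congr rfl fun j _ => ?_
          simp_rw [countIn_eq_restrict]
          exact integral_mul_of_disjoint τ hAB
            ((measurable_restrict_count A (hS i)).mul (measurable_restrict_count A (hS j)))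
            ((measurable_restrict_count B (hS' i)).mul (measurable_restrict_count B (hS' j)))
      _ ≤ ∑ i ∈ I, ∑ j ∈ I, (α i * α j + if i = j then α i else 0) *
          (β i * β j + if i = j then β i else 0) := by
          refine Finset.sum_le_sum fun i _ => Finset.sum_le_sum fun j _ => ?_
          refine mul_le_mul (integral_countIn_mul_le τ A hS hd i j)
            (integral_countIn_mul_le τ B hS' hd' i j)
            (integral_nonneg fun ω => mul_nonneg (countIn_nonneg _ _ _) (countIn_nonneg _ _ _)) ?_
          have := hα0 i
          have := hα0 j
          positivity
      -- Diagonal terms: `(α² + α)(β² + β) = (αβ)² + αβ(1 + α + β)`.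
      _ = ∑ i ∈ I, ∑ j ∈ I, ((α i * β i) * (α j * β j) +
          if i = j then (α i * β i) * (1 + α i + β i) else 0) := by
          refine Finset.sum_congr rfl fun i _ => Finset.sum_congr rfl fun j _ => ?_
          split_ifs with h
          · subst h; ring
          · ring
      _ = M ^ 2 + ∑ i ∈ I, (α i * β i) * (1 + α i + β i) := by
          simp only [Finset.sum_add_distrib, Finset.sum_ite_eq, Finset.sum_ite_mem,
            Finset.inter_self]
          rw [hM, sq, Finset.sum_mul_sum]
      _ ≤ M ^ 2 + ∑ i ∈ I, (α i * β i) * (1 + a + b) := by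
          gcongr with i hi
          · exact ha i hi
          · exact hb i hi
      _ = _ := by rw [← Finset.sum_mul, ← hM]
  set t : ℝ := 1 / (M + (1 + a + b)) with ht
  have hDpos : 0 < M + (1 + a + b) := by positivity
  have hXi : Integrable X μ := integrable_finsetSum _ fun i _ => hint1 i
  have hX2i : Integrable (fun ω => X ω ^ 2) μ := by
    simp_rw [hXsq]
    exact integrable_finsetSum _ fun i _ => integrable_finsetSum _ fun j _ => hint2 i j
  -- Expanding `(1 - t X)² ≥ 0` linearizes the Cauchy–Schwarz bound for `X ≠ 0`. With the bound on
  -- the second moment, this `t` gives exactly `t M`.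
  have hpt : ∀ ω, 2 * t * X ω - t ^ 2 * X ω ^ 2 ≤ E.indicator (fun _ => (1 : ℝ)) ω := by
    intro ω
    by_cases hω : ω ∈ E
    · rw [Set.indicator_of_mem hω]
      nlinarith [sq_nonneg (1 - t * X ω)]
    · rw [Set.indicator_of_notMem hω]
      have : X ω = 0 := by
        refine Finset.sum_eq_zero fun i hi => ?_
        by_contra hne
        obtain ⟨u, hu, h1⟩ := exists_mem_of_countIn_ne_zero (left_ne_zero_of_mul hne)
        obtain ⟨v, hv, h2⟩ := exists_mem_of_countIn_ne_zero (right_ne_zero_of_mul hne)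
        exact hω ⟨i, hi, u, hu, v, hv, h1, h2⟩
      simp [this]
  calc M / (M + (1 + a + b)) = 2 * t * M - t ^ 2 * (M ^ 2 + M * (1 + a + b)) := by
        rw [ht]; field_simp; ring
    _ ≤ 2 * t * (∫ ω, X ω ∂μ) - t ^ 2 * ∫ ω, X ω ^ 2 ∂μ := by
        rw [hX1]; gcongr
    _ = ∫ ω, (2 * t * X ω - t ^ 2 * X ω ^ 2) ∂μ := by
        rw [integral_sub (hXi.const_mul _) (hX2i.const_mul _), integral_const_mul,
          integral_const_mul]
    _ ≤ ∫ ω, E.indicator (fun _ => (1 : ℝ)) ω ∂μ :=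
        integral_mono ((hXi.const_mul _).sub (hX2i.const_mul _))
          ((integrable_const _).indicator hEm) hpt
    _ = μ.real E := by rw [integral_indicator_const _ hEm]; simp

end SecondMoment

/-! ### Separated cells and the lower bound by one link per cell. -/

section Achievability

variable {n m : ℕ}

/-- The law of the data (position, cached file, requested file) of one user. -/
noncomputable def userLaw (γr γc : ℝ) (m : ℕ) : Measure ((Plane × Fin m) × Fin m) :=
  (uniformSquare.prod (zipf γc m)).prod (zipf γr m)

theorem isProbabilityMeasure_userLaw (γr γc : ℝ) (hm : 0 < m) :
    IsProbabilityMeasure (userLaw γr γc m) := by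
  have := isProbabilityMeasure_zipf γr hm
  have := isProbabilityMeasure_zipf γc hm
  unfold userLaw
  infer_instance

/-- Under independent Zipf caching the users are independent and identically distributed. -/
theorem measurePreserving_networkLaw (γr γc : ℝ) (n : ℕ) (hm : 0 < m) :
    MeasurePreserving (fun ω : Fin n → (Plane × Fin m) × Fin m =>
      (((fun u => (ω u).1.1, fun u => (ω u).1.2), fun u => (ω u).2) :
        ((Fin n → Plane) × (Fin n → Fin m)) × (Fin n → Fin m)))
      (Measure.pi fun _ : Fin n => userLaw γr γc m) (networkLaw γr n m (zipfCaching γc n m)) := by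
  have := isProbabilityMeasure_zipf γr hm
  have := isProbabilityMeasure_zipf γc hm
  have h1 := measurePreserving_arrowProdEquivProdArrow (Plane × Fin m) (Fin m) (Fin n)
    (fun _ => uniformSquare.prod (zipf γc m)) (fun _ => zipf γr m)
  have h2 := (measurePreserving_arrowProdEquivProdArrow Plane (Fin m) (Fin n)
    (fun _ => uniformSquare) (fun _ => zipf γc m)).prod
    (MeasurePreserving.id (Measure.pi fun _ : Fin n => zipf γr m))
  rw [networkLaw, zipfCaching, Measure.compProd_const]
  exact h2.comp h1

/-- Squares of side `r / 2` at mutual distance larger than `r`. -/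
def cell (r : ℝ) {M : ℕ} (p : Fin 2 → Fin M) : Set Plane :=
  {x | ∀ i, x i ∈ Set.Icc (2 * r * (p i : ℕ)) (2 * r * (p i : ℕ) + r / 2)}

theorem dist_lt_of_mem_cell {r : ℝ} (hr : 0 < r) {M : ℕ} {p : Fin 2 → Fin M} {x y : Plane}
    (hx : x ∈ cell r p) (hy : y ∈ cell r p) : dist x y < r := by
  refine lt_of_pow_lt_pow_left₀ 2 hr.le ?_
  rw [dist_sq_plane]
  have h : ∀ i, (x i - y i) ^ 2 ≤ (r / 2) ^ 2 := by
    intro i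
    have h1 := hx i
    have h2 := hy i
    simp only [Set.mem_Icc] at h1 h2
    rw [← sq_abs]
    refine pow_le_pow_left₀ (abs_nonneg _) (abs_le.2 ⟨?_, ?_⟩) 2 <;> linarith
  nlinarith [h 0, h 1]

/-- Along some axis the corners differ by at least `2 r`, and the side `r / 2` leaves a gap of `3/2
r`. -/
theorem lt_dist_of_mem_cell {r : ℝ} (hr : 0 < r) {M : ℕ} {p q : Fin 2 → Fin M} (hpq : p ≠ q)
    {x y : Plane} (hx : x ∈ cell r p) (hy : y ∈ cell r q) : r < dist x y := by
  obtain ⟨i, hi⟩ := Function.ne_iff.1 hpq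
  refine lt_of_pow_lt_pow_left₀ 2 dist_nonneg ?_
  rw [dist_sq_axis x y i]
  have h1 := hx i
  have h2 := hy i
  simp only [Set.mem_Icc] at h1 h2
  have hi' : ((p i : ℕ) : ℝ) + 1 ≤ (q i : ℕ) ∨ ((q i : ℕ) : ℝ) + 1 ≤ (p i : ℕ) := by
    rcases lt_or_gt_of_ne (fun h => hi (Fin.ext h) : (p i : ℕ) ≠ (q i : ℕ)) with h | h
    · left; exact_mod_cast h
    · right; exact_mod_cast h
  have key : 3 / 2 * r ≤ |x i - y i| := by
    rcases hi' with h | h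
    · have := mul_le_mul_of_nonneg_left h (by linarith : 0 ≤ 2 * r)
      rw [abs_sub_comm]
      exact le_trans (by linarith) (le_abs_self _)
    · have := mul_le_mul_of_nonneg_left h (by linarith : 0 ≤ 2 * r)
      exact le_trans (by linarith) (le_abs_self _)
  have h3 := pow_le_pow_left₀ (by positivity) key 2
  rw [sq_abs] at h3
  nlinarith [sq_nonneg (x (1 - i) - y (1 - i))]

theorem measurableSet_cell (r : ℝ) {M : ℕ} (p : Fin 2 → Fin M) : MeasurableSet (cell r p) :=
  measurableSet_plane_box (fun i => 2 * r * (p i : ℕ)) fun i => 2 * r * (p i : ℕ) + r / 2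

theorem uniformSquare_real_cell {r : ℝ} (hr : 0 < r) {M : ℕ} (hM : 2 * r * M ≤ 1)
    (p : Fin 2 → Fin M) : uniformSquare.real (cell r p) = r ^ 2 / 4 := by
  have hsub : cell r p ⊆ unitSquare := by
    intro x hx i
    have h := hx i
    simp only [Set.mem_Icc] at h ⊢
    have h1 : ((p i : ℕ) : ℝ) + 1 ≤ M := by exact_mod_cast (p i).2
    have h2 := mul_le_mul_of_nonneg_left h1 (by linarith : 0 ≤ 2 * r)
    have h3 : 0 ≤ 2 * r * ((p i : ℕ) : ℝ) := by positivity
    constructor <;> linarith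
  have h := volume_plane_box (fun i => 2 * r * (p i : ℕ)) fun i => 2 * r * (p i : ℕ) + r / 2
  rw [add_sub_cancel_left, add_sub_cancel_left, ← ENNReal.ofReal_mul (by positivity)] at h
  rw [Measure.real, uniformSquare, Measure.restrict_eq_self _ hsub]
  change (volume {x : Plane | ∀ i, x i ∈ Set.Icc (2 * r * ((p i : ℕ) : ℝ))
    (2 * r * ((p i : ℕ) : ℝ) + r / 2)}).toReal = _
  rw [h, ENNReal.toReal_ofReal (by positivity)]
  ring

/-- Data of a user in cell `p` that caches file `i`. -/
def transmitterData (r : ℝ) {M : ℕ} (p : Fin 2 → Fin M) (i : Fin m) :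
    Set ((Plane × Fin m) × Fin m) := (cell r p ×ˢ {i}) ×ˢ Set.univ

/-- Data of a user in cell `p` that caches the most popular file `i₀` and requests file `i`. -/
def receiverData (r : ℝ) {M : ℕ} (p : Fin 2 → Fin M) (i₀ i : Fin m) :
    Set ((Plane × Fin m) × Fin m) := (cell r p ×ˢ {i₀}) ×ˢ {i}

/-- The event that cell `p` contains a link from `A` to `B` for a file in `I`. -/
def cellMatch (r : ℝ) {M : ℕ} (i₀ : Fin m) (A B : Finset (Fin n)) (I : Finset (Fin m))
    (p : Fin 2 → Fin M) : Set (Fin n → (Plane × Fin m) × Fin m) :=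
  {ω | ∃ i ∈ I, ∃ u ∈ A, ∃ v ∈ B, ω u ∈ transmitterData r p i ∧ ω v ∈ receiverData r p i₀ i}

theorem measurableSet_transmitterData (r : ℝ) {M : ℕ} (p : Fin 2 → Fin M) (i : Fin m) :
    MeasurableSet (transmitterData r p i) :=
  ((measurableSet_cell r p).prod (measurableSet_singleton _)).prod MeasurableSet.univ

theorem measurableSet_receiverData (r : ℝ) {M : ℕ} (p : Fin 2 → Fin M) (i₀ i : Fin m) :
    MeasurableSet (receiverData r p i₀ i) :=
  ((measurableSet_cell r p).prod (measurableSet_singleton _)).prod (measurableSet_singleton _)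

open Classical in
-- Choosing one link in every matched cell gives a schedule. The receiver caches `i₀ ∉ I`, so its
-- request is not in its own cache.
theorem card_cellMatch_le {r : ℝ} (hr : 0 < r) {M : ℕ} {i₀ : Fin m} {A B : Finset (Fin n)}
    (hAB : Disjoint A B) {I : Finset (Fin m)} (hI : i₀ ∉ I)
    (ω : Fin n → (Plane × Fin m) × Fin m) :
    (Finset.univ.filter fun p : Fin 2 → Fin M => ω ∈ cellMatch r i₀ A B I p).card ≤
      activeLinks r (fun u => (ω u).1.1) (fun u => (ω u).1.2) fun u => (ω u).2 := by
  have hex : ∀ p : Fin 2 → Fin M, ω ∈ cellMatch r i₀ A B I p → ∃ l : Fin n × Fin n,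
      (ω l.1).1.1 ∈ cell r p ∧ (ω l.2).1.1 ∈ cell r p ∧
      PotentiallyActive r (fun u => (ω u).1.1) (fun u => (ω u).1.2) (fun u => (ω u).2) l := by
    rintro p ⟨i, hi, u, hu, v, hv, ⟨⟨h1, h2⟩, -⟩, ⟨⟨h3, h4⟩, h5⟩⟩
    rw [Set.mem_singleton_iff] at h2 h4 h5
    refine ⟨(u, v), h1, h3, ?_, dist_lt_of_mem_cell hr h1 h3, h2.trans h5.symm, ?_⟩
    · rintro (rfl : u = v)
      exact Finset.disjoint_left.1 hAB hu hv
    · show (ω v).1.2 ≠ (ω v).2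
      rw [h4, h5]
      exact fun h => hI (h ▸ hi)
  rcases (Finset.univ.filter fun p : Fin 2 → Fin M =>
    ω ∈ cellMatch r i₀ A B I p).eq_empty_or_nonempty with hemp | ⟨p₀, hp₀⟩
  · rw [hemp]; exact Nat.zero_le _
  have : Nonempty (Fin n × Fin n) := ⟨(hex p₀ (Finset.mem_filter.1 hp₀).2).choose⟩
  choose! l hl using hex
  have hinj : Set.InjOn l (Finset.univ.filter fun p : Fin 2 → Fin M =>
      ω ∈ cellMatch r i₀ A B I p : Finset _) := by
    intro p hp q hq h
    by_contra hne
    have hp := hl p (Finset.mem_filter.1 hp).2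
    have hq := hl q (Finset.mem_filter.1 hq).2
    have := lt_dist_of_mem_cell hr hne hp.1 hq.1
    rw [h, dist_self] at this
    linarith
  rw [← Finset.card_image_of_injOn hinj]
  refine IsSchedule.card_le_activeLinks ⟨?_, ?_⟩
  · intro k hk
    obtain ⟨p, hp, rfl⟩ := Finset.mem_image.1 hk
    exact (hl p (Finset.mem_filter.1 hp).2).2.2
  · intro k hk k' hk' hne
    obtain ⟨p, hp, rfl⟩ := Finset.mem_image.1 hk
    obtain ⟨q, hq, rfl⟩ := Finset.mem_image.1 hk'
    exact lt_dist_of_mem_cell hr (fun h => hne (by rw [h])) (hl p (Finset.mem_filter.1 hp).2).1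
      (hl q (Finset.mem_filter.1 hq).2).2.1

theorem zipf_real_singleton (γ : ℝ) (m : ℕ) (i : Fin m) :
    (zipf γ m).real {i} = zipfProb γ m i := by
  rw [Measure.real, zipf_singleton, ENNReal.toReal_ofReal (zipfProb_nonneg _ _ _)]

/-- Linearity of expectation over the `M ^ 2` cells; the events of different cells need not be
independent. -/
theorem le_expectedActiveLinks_zipfCaching (γr γc : ℝ) (hm : 0 < m) {r : ℝ} (hr : 0 < r) {M : ℕ}
    (hM : 2 * r * M ≤ 1) (i₀ : Fin m) {A B : Finset (Fin n)} (hAB : Disjoint A B)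
    {I : Finset (Fin m)} (hI : i₀ ∉ I) {a b : ℝ} (ha0 : 0 ≤ a) (hb0 : 0 ≤ b)
    (ha : ∀ i ∈ I, A.card * (r ^ 2 / 4 * zipfProb γc m i) ≤ a)
    (hb : ∀ i ∈ I, B.card * (r ^ 2 / 4 * zipfProb γc m i₀ * zipfProb γr m i) ≤ b)
    {W : ℝ} (hW : W = ∑ i ∈ I, (A.card * (r ^ 2 / 4 * zipfProb γc m i)) *
      (B.card * (r ^ 2 / 4 * zipfProb γc m i₀ * zipfProb γr m i))) :
    (M : ℝ) ^ 2 * (W / (W + (1 + a + b))) ≤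
      expectedActiveLinks γr n m r (zipfCaching γc n m) := by
  classical
  have : NeZero m := ⟨hm.ne'⟩
  have := isProbabilityMeasure_userLaw γr γc hm
  have := isProbabilityMeasure_zipf γr hm
  have := isProbabilityMeasure_zipf γc hm
  have hmp := measurePreserving_networkLaw γr γc n hm
  have hS : ∀ (p : Fin 2 → Fin M) (i : Fin m),
      (userLaw γr γc m).real (transmitterData r p i) = r ^ 2 / 4 * zipfProb γc m i := by
    intro p i
    rw [userLaw, transmitterData, measureReal_prod_prod, measureReal_prod_prod,
      uniformSquare_real_cell hr hM, zipf_real_singleton, probReal_univ, mul_one]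
  have hS' : ∀ (p : Fin 2 → Fin M) (i : Fin m), (userLaw γr γc m).real (receiverData r p i₀ i) =
      r ^ 2 / 4 * zipfProb γc m i₀ * zipfProb γr m i := by
    intro p i
    rw [userLaw, receiverData, measureReal_prod_prod, measureReal_prod_prod,
      uniformSquare_real_cell hr hM, zipf_real_singleton, zipf_real_singleton]
  have hcell : ∀ p : Fin 2 → Fin M, W / (W + (1 + a + b)) ≤
      (Measure.pi fun _ : Fin n => userLaw γr γc m).real (cellMatch r i₀ A B I p) := by
    intro p
    refine le_measureReal_exists_match (userLaw γr γc m) hAB I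
      (measurableSet_transmitterData r p) (measurableSet_receiverData r p i₀) ?_ ?_ ha0 hb0
      (fun i hi => by rw [hS]; exact ha i hi) (fun i hi => by rw [hS']; exact hb i hi)
      (by simp_rw [hS, hS']; exact hW)
    · intro i j hij
      refine Set.disjoint_left.2 fun t h1 h2 => hij ?_
      exact (Set.mem_singleton_iff.1 h1.1.2).symm.trans (Set.mem_singleton_iff.1 h2.1.2)
    · intro i j hij
      refine Set.disjoint_left.2 fun t h1 h2 => hij ?_
      exact (Set.mem_singleton_iff.1 h1.2).symm.trans (Set.mem_singleton_iff.1 h2.2)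
  have hmeas : ∀ p : Fin 2 → Fin M, MeasurableSet (cellMatch (n := n) r i₀ A B I p) := by
    intro p
    have : cellMatch (n := n) r i₀ A B I p = ⋃ i ∈ I, ⋃ u ∈ A, ⋃ v ∈ B,
        {ω | ω u ∈ transmitterData r p i} ∩ {ω | ω v ∈ receiverData r p i₀ i} := by
      ext ω
      simp only [cellMatch, Set.mem_ofPred_eq, Set.mem_iUnion, Set.mem_inter_iff, exists_prop]
    rw [this]
    exact Finset.measurableSet_biUnion _ fun i _ => Finset.measurableSet_biUnion _ fun u _ =>
      Finset.measurableSet_biUnion _ fun v _ =>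
        ((measurableSet_transmitterData r p i).preimage (measurable_pi_apply u)).inter
        ((measurableSet_receiverData r p i₀ i).preimage (measurable_pi_apply v))
  have hint := hmp.integrable_comp_of_integrable
    (integrable_activeLinks γr hm r (zipfCaching γc n m))
  have hE : expectedActiveLinks γr n m r (zipfCaching γc n m) =
      ∫ ω, (activeLinks r (fun u => (ω u).1.1) (fun u => (ω u).1.2) (fun u => (ω u).2) : ℝ)
        ∂(Measure.pi fun _ : Fin n => userLaw γr γc m) := by
    rw [expectedActiveLinks, ← hmp.map_eq, integral_map hmp.measurable.aemeasurable]
    rw [hmp.map_eq]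
    exact (integrable_activeLinks γr hm r (zipfCaching γc n m)).aestronglyMeasurable
  rw [hE]
  calc (M : ℝ) ^ 2 * (W / (W + (1 + a + b)))
      = ∑ _p : Fin 2 → Fin M, W / (W + (1 + a + b)) := by simp
    _ ≤ ∑ p : Fin 2 → Fin M,
        (Measure.pi fun _ : Fin n => userLaw γr γc m).real (cellMatch r i₀ A B I p) :=
        Finset.sum_le_sum fun p _ => hcell p
    _ = ∫ ω, ∑ p : Fin 2 → Fin M, (cellMatch r i₀ A B I p).indicator (fun _ => (1 : ℝ)) ω
        ∂(Measure.pi fun _ : Fin n => userLaw γr γc m) := by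
        rw [integral_finsetSum _ fun p _ => (integrable_const _).indicator (hmeas p)]
        refine Finset.sum_congr rfl fun p _ => ?_
        rw [integral_indicator_const _ (hmeas p)]
        simp
    _ ≤ _ := by
        refine integral_mono (integrable_finsetSum _ fun p _ =>
          (integrable_const _).indicator (hmeas p)) hint fun ω => ?_
        have h := card_cellMatch_le (M := M) hr hAB hI ω
        rw [Finset.card_filter] at h
        have h' : ((∑ p : Fin 2 → Fin M, if ω ∈ cellMatch r i₀ A B I p then 1 else 0 : ℕ) : ℝ) ≤
          (activeLinks r (fun u => (ω u).1.1) (fun u => (ω u).1.2) (fun u => (ω u).2) : ℝ) := by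
          exact_mod_cast h
        refine le_trans (le_of_eq ?_) h'
        push_cast
        exact Finset.sum_congr rfl fun p _ => Set.indicator_apply _ _ _

end Achievability

/-! ### The lower bound at density `n r²` of order `m ^ θ`, and the order of `E[L]`. -/

theorem half_le_floor {y : ℝ} (hy : 1 ≤ y) : y / 2 ≤ (⌊y⌋₊ : ℝ) := by
  have h1 := Nat.lt_floor_add_one y
  have h2 : (1 : ℝ) ≤ (⌊y⌋₊ : ℝ) := by exact_mod_cast Nat.floor_pos.2 hy
  linarith

theorem div_add_le_div_add {w W d : ℝ} (hw : 0 < w) (hd : 0 < d) (h : w ≤ W) :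
    w / (w + d) ≤ W / (W + d) := by
  rw [div_le_div_iff₀ (by linarith) (by linarith)]
  nlinarith

set_option maxHeartbeats 1000000 in
/-- Lower bound for independent Zipf caching with `n r²` of order `m ^ θ`. -/
theorem le_expectedActiveLinks_of_density {γr γc θ c D : ℝ} (hγ0 : 0 ≤ γr) (hγ1 : γr < 1)
    (hγc : 1 < γc) (hθ : (1 - γr) * γc / (1 - γr + γc) = θ) (hc : 0 < c) (hD : 0 < D) :
    ∃ C : ℝ, 0 < C ∧ ∀ (n m : ℕ) (r : ℝ), 2 ≤ n → 0 < m → 4 * (m : ℝ) ^ (θ / γc) ≤ m →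
      0 < r → r ≤ 1 / 2 → c * (m : ℝ) ^ θ ≤ n * r ^ 2 → n * r ^ 2 ≤ D * (m : ℝ) ^ θ →
      C * ((n : ℝ) / (m : ℝ) ^ θ) ≤ expectedActiveLinks γr n m r (zipfCaching γc n m) := by
  have ha : 0 < 1 - γr := by linarith
  have hc1 : 0 < γc - 1 := by linarith
  have hac : 0 < 1 - γr + γc := by linarith
  have hθ0 : 0 < θ := by rw [← hθ]; positivity
  set H : ℝ := 1 + 2 ^ (γc - 1) / (γc - 1) with hH
  have hH0 : 0 < H := by positivity
  -- `α` and `β / y` bound from below the expected transmitters and receivers per file and cell: 12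
  -- is a third of the users times a quarter of `r²`, the powers of 4 come from ranks up to `4 y`,
  -- and `H` bounds the caching normalizer.
  set α : ℝ := c / (12 * 4 ^ γc * H) with hα
  set β : ℝ := c * (1 - γr) / (12 * 4 ^ γr * H) with hβ
  have hα0 : 0 < α := by positivity
  have hβ0 : 0 < β := by positivity
  refine ⟨α * β / (α * β + (1 + D + D)) / (16 * D), by positivity, ?_⟩
  intro n m r hn hm hsmall hr hr2 hcn hDn
  have hm' : (0 : ℝ) < m := by exact_mod_cast hm
  have hm1 : (1 : ℝ) ≤ m := by exact_mod_cast hm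
  have hn' : (0 : ℝ) < n := by exact_mod_cast (by omega : 0 < n)
  set y : ℝ := (m : ℝ) ^ (θ / γc) with hy
  have hy1 : 1 ≤ y := Real.one_le_rpow hm1 (by positivity)
  have hy0 : 0 < y := by linarith
  set Θ : ℝ := (m : ℝ) ^ θ with hΘ
  have hΘ0 : 0 < Θ := by positivity
  have hyc : y ^ γc = Θ := by
    rw [hy, ← Real.rpow_mul hm'.le, div_mul_cancel₀ _ (by linarith)]
  have hma : (m : ℝ) ^ (1 - γr) = y ^ (1 - γr + γc) := by
    rw [hy, ← Real.rpow_mul hm'.le]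
    congr 1
    rw [← hθ]; field_simp
  -- A file of rank about `y` is thus requested with probability of order `1 / (y Θ)`, while `y ^ γc
  -- = Θ` gives caching probability of order `1 / Θ`.
  have hyr : y ^ γr * (m : ℝ) ^ (1 - γr) = y * Θ := by
    rw [hma, ← hyc, ← Real.rpow_add hy0, ← Real.rpow_one_add' hy0.le (by linarith)]
    congr 1; ring
  set K : ℕ := ⌈y⌉₊ with hK
  have hKy : y ≤ K := Nat.le_ceil y
  have hKy2 : (K : ℝ) ≤ 2 * y := by
    have := Nat.ceil_lt_add_one hy0.le
    linarith
  have hK1 : 1 ≤ K := Nat.one_le_ceil_iff.2 hy0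
  have hKm : 2 * K ≤ m := by
    have : (2 * K : ℝ) ≤ m := by linarith
    exact_mod_cast this
  -- About `y` files, with ranks between `y` and `4 y`; `K ≥ 1` keeps the most popular file out.
  set I : Finset (Fin m) := (Finset.Ico K (2 * K)).attachFin
    fun i hi => (Finset.mem_Ico.1 hi).2.trans_le hKm with hI
  set A : Finset (Fin n) := (Finset.range (n / 2)).attachFin
    fun i hi => (Finset.mem_range.1 hi).trans_le (Nat.div_le_self n 2) with hA
  set B : Finset (Fin n) := (Finset.Ico (n / 2) n).attachFin
    fun i hi => (Finset.mem_Ico.1 hi).2 with hB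
  have hAB : Disjoint A B := by
    refine Finset.disjoint_left.2 fun u hu hv => ?_
    have h1 := Finset.mem_range.1 ((Finset.mem_attachFin _).1 hu)
    have h2 := (Finset.mem_Ico.1 ((Finset.mem_attachFin _).1 hv)).1
    omega
  have hIc : I.card = K := by rw [hI, Finset.card_attachFin, Nat.card_Ico]; omega
  have hAc : (n : ℝ) / 3 ≤ A.card ∧ (A.card : ℝ) ≤ n := by
    rw [hA, Finset.card_attachFin, Finset.card_range]
    refine ⟨?_, by exact_mod_cast Nat.div_le_self n 2⟩
    have : (n : ℝ) ≤ 3 * (n / 2 : ℕ) := by exact_mod_cast (by omega : n ≤ 3 * (n / 2))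
    linarith
  have hBc : (n : ℝ) / 3 ≤ B.card ∧ (B.card : ℝ) ≤ n := by
    rw [hB, Finset.card_attachFin, Nat.card_Ico]
    refine ⟨?_, by exact_mod_cast Nat.sub_le _ _⟩
    have : (n : ℝ) ≤ 3 * (n - n / 2 : ℕ) := by exact_mod_cast (by omega : n ≤ 3 * (n - n / 2))
    linarith
  set i₀ : Fin m := ⟨0, hm⟩ with hi₀
  have hi₀I : i₀ ∉ I := by
    intro h
    have := (Finset.mem_Ico.1 ((Finset.mem_attachFin _).1 h)).1
    simp only [hi₀] at this
    omega
  have hIy : ∀ i ∈ I, y ≤ ((i : ℕ) : ℝ) + 1 ∧ ((i : ℕ) : ℝ) + 1 ≤ 4 * y := by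
    intro i hi
    have h := Finset.mem_Ico.1 ((Finset.mem_attachFin _).1 hi)
    have h1 : (K : ℝ) ≤ (i : ℕ) := by exact_mod_cast h.1
    have h2 : ((i : ℕ) : ℝ) + 1 ≤ 2 * K := by exact_mod_cast h.2
    constructor <;> linarith
  have hzs1 : 1 ≤ zipfSum γc m := one_le_zipfSum hm
  have hzsH : zipfSum γc m ≤ H := zipfSum_le_of_one_lt hγc m
  have hg₀ : 1 / H ≤ zipfProb γc m i₀ ∧ zipfProb γc m i₀ ≤ 1 := by
    have e : zipfProb γc m i₀ = 1 / zipfSum γc m := by simp [zipfProb_eq, hi₀]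
    rw [e]
    exact ⟨one_div_le_one_div_of_le (by linarith) hzsH, (div_le_one (by linarith)).2 hzs1⟩
  have hg : ∀ i ∈ I, 1 / (4 ^ γc * Θ * H) ≤ zipfProb γc m i ∧ zipfProb γc m i ≤ 1 / Θ := by
    intro i hi
    obtain ⟨h1, h2⟩ := hIy i hi
    rw [zipfProb_eq, div_div, ← hyc, ← Real.mul_rpow (by norm_num) hy0.le]
    constructor
    · gcongr
    · refine one_div_le_one_div_of_le (by positivity) ?_
      calc y ^ γc = y ^ γc * 1 := (mul_one _).symm
        _ ≤ _ := by gcongr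
  have hf : ∀ i ∈ I, (1 - γr) / (4 ^ γr * (y * Θ)) ≤ zipfProb γr m i ∧
      zipfProb γr m i ≤ 1 / (y * Θ) := by
    intro i hi
    obtain ⟨h1, h2⟩ := hIy i hi
    have hz1 := rpow_le_zipfSum hγ0 hm
    have hz2 := zipfSum_le hγ0 hγ1 m
    have hz0 := zipfSum_pos (γ := γr) hm
    rw [zipfProb_eq, div_div, ← hyr, ← mul_assoc, ← Real.mul_rpow (by norm_num) hy0.le]
    constructor
    · calc (1 - γr) / ((4 * y) ^ γr * (m : ℝ) ^ (1 - γr))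
          = 1 / ((4 * y) ^ γr * ((m : ℝ) ^ (1 - γr) / (1 - γr))) := by field_simp
        _ ≤ _ := by gcongr
    · gcongr
  have hup : ∀ i ∈ I, A.card * (r ^ 2 / 4 * zipfProb γc m i) ≤ D := by
    intro i hi
    calc A.card * (r ^ 2 / 4 * zipfProb γc m i) ≤ n * (r ^ 2 / 4 * (1 / Θ)) := by
          gcongr
          · exact mul_nonneg (by positivity) (zipfProb_nonneg _ _ _)
          · exact_mod_cast hAc.2
          · exact (hg i hi).2
      _ = (n * r ^ 2) * (1 / (4 * Θ)) := by field_simp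
      _ ≤ (D * Θ) * (1 / (4 * Θ)) := by gcongr
      _ = D / 4 := by field_simp
      _ ≤ D := by linarith
  have hup' : ∀ i ∈ I, B.card * (r ^ 2 / 4 * zipfProb γc m i₀ * zipfProb γr m i) ≤ D := by
    intro i hi
    calc B.card * (r ^ 2 / 4 * zipfProb γc m i₀ * zipfProb γr m i)
        ≤ n * (r ^ 2 / 4 * 1 * (1 / (y * Θ))) := by
          have h0 := zipfProb_nonneg γc m i₀
          have h1 := zipfProb_nonneg γr m i
          gcongr
          · exact_mod_cast hBc.2
          · exact hg₀.2
          · exact (hf i hi).2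
      _ = (n * r ^ 2) * (1 / (4 * (y * Θ))) := by field_simp
      _ ≤ (D * Θ) * (1 / (4 * (y * Θ))) := by gcongr
      _ = D / (4 * y) := by field_simp
      _ ≤ D := div_le_self hD.le (by linarith)
  have hlow : ∀ i ∈ I, α ≤ A.card * (r ^ 2 / 4 * zipfProb γc m i) := by
    intro i hi
    calc α = (c * Θ) * (1 / (12 * (4 ^ γc * Θ * H))) := by rw [hα]; field_simp
      _ ≤ (n * r ^ 2) * (1 / (12 * (4 ^ γc * Θ * H))) := by gcongr
      _ = n / 3 * (r ^ 2 / 4 * (1 / (4 ^ γc * Θ * H))) := by field_simp; norm_num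
      _ ≤ _ := by
          gcongr
          · exact hAc.1
          · exact (hg i hi).1
  have hlow' : ∀ i ∈ I, β / y ≤ B.card * (r ^ 2 / 4 * zipfProb γc m i₀ * zipfProb γr m i) := by
    intro i hi
    calc β / y = (c * Θ) * (1 / (12 * H) * ((1 - γr) / (4 ^ γr * (y * Θ)))) := by
          rw [hβ]; field_simp
      _ ≤ (n * r ^ 2) * (1 / (12 * H) * ((1 - γr) / (4 ^ γr * (y * Θ)))) := by gcongr
      _ = n / 3 * (r ^ 2 / 4 * (1 / H) * ((1 - γr) / (4 ^ γr * (y * Θ)))) := by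
          field_simp; norm_num
      _ ≤ _ := by
          have h0 := zipfProb_nonneg γc m i₀
          gcongr
          · exact hBc.1
          · exact hg₀.1
          · exact (hf i hi).1
  obtain ⟨W, hW⟩ : ∃ W, W = ∑ i ∈ I, (A.card * (r ^ 2 / 4 * zipfProb γc m i)) *
      (B.card * (r ^ 2 / 4 * zipfProb γc m i₀ * zipfProb γr m i)) := ⟨_, rfl⟩
  -- At least `y` files compensate the factor `1 / y` in the receiver count.
  have hWlow : α * β ≤ W := by
    calc α * β = y * (α * (β / y)) := by field_simp
      _ ≤ K * (α * (β / y)) := by gcongr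
      _ = ∑ _i ∈ I, α * (β / y) := by rw [Finset.sum_const, hIc, nsmul_eq_mul]
      _ ≤ W := by
          rw [hW]
          refine Finset.sum_le_sum fun i hi => ?_
          exact mul_le_mul (hlow i hi) (hlow' i hi) (by positivity) (hα0.le.trans (hlow i hi))
  set M : ℕ := ⌊1 / (2 * r)⌋₊ with hM
  have hMr : 2 * r * M ≤ 1 := by
    have := Nat.floor_le (by positivity : 0 ≤ 1 / (2 * r))
    rw [le_div_iff₀ (by positivity)] at this
    rw [mul_comm]
    exact this
  have hMlow : 1 / (4 * r) ≤ M := by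
    refine le_trans (le_of_eq ?_) (half_le_floor (y := 1 / (2 * r)) ?_)
    · field_simp; norm_num
    · rw [le_div_iff₀ (by positivity)]; linarith
  refine le_trans ?_ (le_expectedActiveLinks_zipfCaching γr γc hm hr hMr i₀ hAB hi₀I hD.le hD.le
    hup hup' hW)
  have hp : α * β / (α * β + (1 + D + D)) ≤ W / (W + (1 + D + D)) :=
    div_add_le_div_add (by positivity) (by positivity) hWlow
  have hαβ : 0 < α * β / (α * β + (1 + D + D)) := by positivity
  calc α * β / (α * β + (1 + D + D)) / (16 * D) * (n / Θ)
      = n / (D * Θ) / 16 * (α * β / (α * β + (1 + D + D))) := by field_simp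
    _ ≤ (1 / r ^ 2) / 16 * (α * β / (α * β + (1 + D + D))) := by
        gcongr ?_ / _ * _
        rw [div_le_div_iff₀ (by positivity) (by positivity)]
        linarith
    _ = (1 / (4 * r)) ^ 2 * (α * β / (α * β + (1 + D + D))) := by field_simp; norm_num
    _ ≤ (M : ℝ) ^ 2 * (W / (W + (1 + D + D))) := by gcongr

/-- The order of `E[L]` under independent Zipf caching at the matching collaboration distance. -/
theorem isTheta_expectedActiveLinks_zipfCaching {γr γc θ : ℝ} (hγ0 : 0 ≤ γr) (hγ1 : γr < 1)
    (hγc : 1 < γc) (hθ : (1 - γr) * γc / (1 - γr + γc) = θ) {m : ℕ → ℕ} {r : ℕ → ℝ}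
    (hm : Tendsto m atTop atTop) (hmn : (fun n => (m n : ℝ)) =o[atTop] (fun n : ℕ => (n : ℝ)))
    (hr : ∀ n, 0 < r n)
    (hrθ : r =Θ[atTop] (fun n : ℕ => √((m n : ℝ) ^ θ / (n : ℝ)))) :
    (fun n : ℕ => expectedActiveLinks γr n (m n) (r n) (zipfCaching γc n (m n)))
      =Θ[atTop] (fun n : ℕ => (n : ℝ) / (m n : ℝ) ^ θ) := by
  have ha : 0 < 1 - γr := by linarith
  have hac : 0 < 1 - γr + γc := by linarith
  have hθ0 : 0 < θ := by
    rw [← hθ]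
    exact div_pos (mul_pos ha (by linarith)) hac
  have hθ1 : θ ≤ 1 := by
    rw [← hθ, div_le_one hac]
    nlinarith
  have hθc : θ / γc < 1 := by
    rw [div_lt_one (by linarith), ← hθ, div_lt_iff₀ hac]
    nlinarith
  obtain ⟨C₁, hC₁, h₁⟩ := hrθ.1.exists_pos
  obtain ⟨C₂, hC₂, h₂⟩ := hrθ.2.exists_pos
  have h₁ := h₁.bound
  have h₂ := h₂.bound
  have hnonneg : ∀ n, 0 ≤ expectedActiveLinks γr n (m n) (r n) (zipfCaching γc n (m n)) :=
    fun n => integral_nonneg fun _ => Nat.cast_nonneg _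
  have hup : ∀ᶠ n : ℕ in atTop, (n : ℝ) * r n ^ 2 ≤ C₁ ^ 2 * (m n : ℝ) ^ θ := by
    filter_upwards [h₁, eventually_gt_atTop 0] with n h hn
    have hn' : (0 : ℝ) < n := by exact_mod_cast hn
    rw [Real.norm_of_nonneg (hr n).le, Real.norm_of_nonneg (Real.sqrt_nonneg _)] at h
    have h' := pow_le_pow_left₀ (hr n).le h 2
    rw [mul_pow, Real.sq_sqrt (by positivity)] at h'
    calc (n : ℝ) * r n ^ 2 ≤ n * (C₁ ^ 2 * ((m n : ℝ) ^ θ / n)) := by gcongr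
      _ = _ := by field_simp
  have hlow : ∀ᶠ n : ℕ in atTop, (C₂ ^ 2)⁻¹ * (m n : ℝ) ^ θ ≤ n * r n ^ 2 := by
    filter_upwards [h₂, eventually_gt_atTop 0] with n h hn
    have hn' : (0 : ℝ) < n := by exact_mod_cast hn
    rw [Real.norm_of_nonneg (hr n).le, Real.norm_of_nonneg (Real.sqrt_nonneg _)] at h
    have h' := pow_le_pow_left₀ (Real.sqrt_nonneg _) h 2
    rw [mul_pow, Real.sq_sqrt (by positivity), div_le_iff₀ hn'] at h'
    rw [inv_mul_le_iff₀ (by positivity)]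
    linarith
  have hmpos : ∀ᶠ n : ℕ in atTop, 0 < m n := hm.eventually_gt_atTop 0
  -- Since `θ ≤ 1`, `r²` is at most `C₁² m / n`, which tends to 0 by `m = o(n)`. Then at least one
  -- cell fits along each side.
  have hrsmall : ∀ᶠ n : ℕ in atTop, r n ≤ 1 / 2 := by
    filter_upwards [hup, hmpos, eventually_gt_atTop 0,
      hmn.bound (c := 1 / (4 * C₁ ^ 2)) (by positivity)] with n h hmn0 hn hb
    have hn' : (0 : ℝ) < n := by exact_mod_cast hn
    have hm1 : (1 : ℝ) ≤ m n := by exact_mod_cast hmn0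
    rw [Real.norm_of_nonneg (by positivity), Real.norm_of_nonneg (by positivity)] at hb
    have hpow : (m n : ℝ) ^ θ ≤ m n := by
      calc (m n : ℝ) ^ θ ≤ (m n : ℝ) ^ (1 : ℝ) := Real.rpow_le_rpow_of_exponent_le hm1 hθ1
        _ = _ := Real.rpow_one _
    have h3 : (n : ℝ) * r n ^ 2 ≤ n * (1 / 2) ^ 2 := by
      calc (n : ℝ) * r n ^ 2 ≤ C₁ ^ 2 * (m n : ℝ) ^ θ := h
        _ ≤ C₁ ^ 2 * (1 / (4 * C₁ ^ 2) * n) := by gcongr; exact hpow.trans hb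
        _ = _ := by field_simp; norm_num
    exact le_of_sq_le_sq (le_of_mul_le_mul_left h3 hn') (by norm_num)
  -- `θ / γc < 1`, so the files of rank up to `4 m ^ (θ / γc)` eventually lie in the library.
  have hlib : ∀ᶠ n : ℕ in atTop, 4 * (m n : ℝ) ^ (θ / γc) ≤ m n := by
    have ht : Tendsto (fun n => (m n : ℝ) ^ (1 - θ / γc)) atTop atTop :=
      (tendsto_rpow_atTop (by linarith)).comp (tendsto_natCast_atTop_atTop.comp hm)
    filter_upwards [ht.eventually_ge_atTop 4, hmpos] with n h hmn0
    have hm' : (0 : ℝ) < m n := by exact_mod_cast hmn0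
    calc 4 * (m n : ℝ) ^ (θ / γc) ≤ (m n : ℝ) ^ (1 - θ / γc) * (m n : ℝ) ^ (θ / γc) := by gcongr
      _ = m n := by rw [← Real.rpow_add hm', sub_add_cancel, Real.rpow_one]
  obtain ⟨C, hC, hCle⟩ := le_expectedActiveLinks_of_density hγ0 hγ1 hγc hθ
    (c := (C₂ ^ 2)⁻¹) (D := C₁ ^ 2) (by positivity) (by positivity)
  refine ⟨IsBigO.of_bound (1 / (1 - γr) + 4 * C₁ ^ 2 * (2 ^ (γc - 1) / (γc - 1))) ?_,
    IsBigO.of_bound C⁻¹ ?_⟩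
  · filter_upwards [hup, hmpos] with n h hmn0
    rw [Real.norm_of_nonneg (hnonneg n), Real.norm_of_nonneg (by positivity)]
    exact expectedActiveLinks_zipfCaching_le hγ0 hγ1 hγc hθ hmn0 (hr n).le h
  · filter_upwards [hup, hlow, hmpos, hrsmall, hlib, eventually_ge_atTop 2] with n h1 h2 h3 h4 h5 h6
    rw [Real.norm_of_nonneg (hnonneg n), Real.norm_of_nonneg (by positivity),
      le_inv_mul_iff₀ hC]
    exact hCle n (m n) (r n) h6 h3 h5 (hr n) h4 h2 h1

end D2D

/-! ### The theorem. -/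

theorem theorem2 (γr : ℝ) (hγ0 : 0 ≤ γr) (hγ1 : γr < 1) :
    -- upper bound, for every collaboration distance and every caching policy
    (∃ C : ℝ, 0 < C ∧
      ∀ (n m : ℕ) (r : ℝ) (κ : Kernel (Fin n → D2D.Plane) (Fin n → Fin m)), IsMarkovKernel κ →
        D2D.expectedActiveLinks γr n m r κ ≤ C * ((n : ℝ) / (m : ℝ) ^ D2D.eta γr)) ∧
    -- achievability by independent Zipf caching
    (∀ ε : ℝ, 0 < ε → ε < 1 / 6 →
      (D2D.eta γr + ε < 1 - γr →
        ∃ γc : ℝ, 0 < γc ∧ (1 - γr) * γc / (1 - γr + γc) = D2D.eta γr + ε) ∧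
      ∀ γc : ℝ, 0 < γc → (1 - γr) * γc / (1 - γr + γc) = D2D.eta γr + ε →
        ∀ (m : ℕ → ℕ) (r : ℕ → ℝ),
          Tendsto m atTop atTop →
          (fun n => (m n : ℝ)) =o[atTop] (fun n : ℕ => (n : ℝ)) →
          (∀ n, 0 < r n) →
          r =Θ[atTop] (fun n : ℕ => √((m n : ℝ) ^ (D2D.eta γr + ε) / (n : ℝ))) →
          (fun n : ℕ =>
              D2D.expectedActiveLinks γr n (m n) (r n) (D2D.zipfCaching γc n (m n)))
            =Θ[atTop] (fun n : ℕ => (n : ℝ) / (m n : ℝ) ^ (D2D.eta γr + ε))) := by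
  have ha : 0 < 1 - γr := by linarith
  have h2 : 0 < 2 - γr := by linarith
  have hη : 0 < D2D.eta γr := div_pos ha h2
  refine ⟨⟨152 + 1 / (1 - γr), by positivity, fun n m r κ hκ =>
    D2D.expectedActiveLinks_le_of_any_policy hγ0 hγ1 r κ⟩, ?_⟩
  intro ε hε _
  refine ⟨fun hlt => ?_, ?_⟩
  · have hd : 0 < 1 - γr - (D2D.eta γr + ε) := by linarith
    -- After clearing the denominator the equation is linear in `γc`; this is its root.
    refine ⟨(1 - γr) * (D2D.eta γr + ε) / (1 - γr - (D2D.eta γr + ε)), by positivity, ?_⟩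
    have hs : 1 - γr + (1 - γr) * (D2D.eta γr + ε) / (1 - γr - (D2D.eta γr + ε)) =
        (1 - γr) ^ 2 / (1 - γr - (D2D.eta γr + ε)) := by
      field_simp; ring
    rw [hs]
    field_simp
  · intro γc hγc0 hθ m r hm hmn hr hrθ
    -- The left side of the equation increases with `γc` and equals `η` at `γc = 1`; its value here
    -- is `η + ε > η`.
    have hγc : 1 < γc := by
      have h : D2D.eta γr < (1 - γr) * γc / (1 - γr + γc) := by linarith
      rw [D2D.eta, div_lt_div_iff₀ h2 (by linarith), mul_assoc] at h
      have h := lt_of_mul_lt_mul_left h ha.le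
      nlinarith
    exact D2D.isTheta_expectedActiveLinks_zipfCaching hγ0 hγ1 hγc hθ hm hmn hr hrθ
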